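/- Let $\phi=\frac{1+\sqrt5}{2}$. Let $P$ be a regular pentagon in the plane with a horizontal bottom side, and label its sides, counterclockwise from the bottom side, by $1,3,5,2,4$ (labels are taken modulo $5$). Let $P'$ be the image of $P$ under a point reflection, with each side of $P'$ carrying the label of the side of $P$ parallel to it. The \emph{double pentagon} is obtained from $P\sqcup P'$ by identifying the sides with equal labels by translations. The \emph{symbolic orbit} of a closed linear trajectory (traversed once and avoiding the vertices) is the cyclic word of the labels of the consecutively crossed sides. Identify the set of directions (up to sign) with $\mathbb R\cup\{\infty\}$ by the projective coordinate in which the directions at the angles $180^\circ,216^\circ,252^\circ,288^\circ,324^\circ$ have the coordinates $1-\frac\phi2,\ \frac\phi2,\ \infty,\ -\frac\phi2,\ \frac\phi2-1$; regard $\mathbb R\cup\{\infty\}$ as the absolute of the hyperbolic plane. These five points are the vertices of an ideal pentagon, the pentagon of generation $0$. Reflecting it in its side joining $\alpha:=1-\frac\phi2$ and $\frac\phi2-1$ gives the pentagon of generation $1$, whose vertices, in order from $\alpha$ to $\frac\phi2-1$ on the arc $[\frac\phi2-1,1-\frac\phi2]$, are denoted $\alpha=\alpha_0,\alpha_1,\alpha_2,\alpha_3,\alpha_4$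 (so $\alpha_4=\frac\phi2-1$). Inductively, if a pentagon of generation $k\ge1$ has consecutive vertices $\alpha_{n_1\dots n_{k-1}0},\dots,\alpha_{n_1\dots n_{k-1}4}$, then for $0\le n_k\le 3$ its reflection in the side joining $\alpha_{n_1\dots n_{k-1}n_k}$ and $\alpha_{n_1\dots n_{k-1}(n_k+1)}$ is a pentagon of generation $k+1$, whose vertices, listed along the arc from the first of these two points to the second, are denoted $\alpha_{n_1\dots n_k0},\dots,\alpha_{n_1\dots n_k4}$. For each of these directions call a symbolic orbit \emph{short} (respectively \emph{long}) if, among all closed trajectories in this direction, it has the least (respectively greatest) number of symbols, a tie being broken by the Euclidean length of the trajectory. Let $G$ be the path graph $1-4-3-2-5$. For a cyclic word $w$ in the labels and $j\in\{1,2,3,4\}$ let $w^{(j)}$ be obtained by adding $j$ modulo $5$ to every symbol of $w$, and then inserting between every two cyclically consecutive symbols the vertices passed, in order, when one travels along $G$ from the first symbol to the second. \textbf{Theorem.} Let $k\ge1$, $0\le n_1,\dots,n_{k-1}\le3$, $1\le n_k\le3$, and $j\in\{1,2,3,4\}$. If $w$ is a short symbolic orbit of the direction $\alpha_{n_1n_2\dots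 n_k}$, then $w^{(j)}$ is a short symbolic orbit of the direction $$\alpha_{j-1,\,3-n_1,\,3-n_2,\,\dots,\,3-n_{k-1},\,4-n_k};$$ if $w$ is a long symbolic orbit of $\alpha_{n_1n_2\dots n_k}$, then $w^{(j)}$ is a long symbolic orbit of this direction. Likewise for $k=0$: if $w$ is a short (long) symbolic orbit of the direction $\alpha$, then $w^{(j)}$ is a short (long) symbolic orbit of the direction $\alpha_j$, $j=1,2,3,4$. -/

import Mathlib

noncomputable section

namespace DoublePentagon

/-! ### The generating graph and the combinatorial operations on cyclic words

Side labels `1, 2, 3, 4, 5` are elements of `ZMod 5` (so the label `5` is `0`), and the cyclic shift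
of labels by `j` is addition of `j`. A cyclic word is given by a list, read cyclically. -/

/-- The generating graph: the path `1 - 4 - 3 - 2 - 5`. -/
def generatingGraph : SimpleGraph (ZMod 5) :=
  SimpleGraph.fromEdgeSet {s(1, 4), s(4, 3), s(3, 2), s(2, 5)}

/-- The vertices of the generating graph in the order in which they lie on the path. -/
def graphLine : List (ZMod 5) := [1, 4, 3, 2, 5]

/-- The position of a vertex on the path. -/
def graphPos (a : ZMod 5) : ℕ := graphLine.idxOf a

/-- The intermediate vertices passed when one travels along the generating graph from `a` to `b`,
in the order of travel. -/
def intermediate (a b : ZMod 5) : List (ZMod 5) :=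
  if graphPos a ≤ graphPos b then (graphLine.take (graphPos b)).drop (graphPos a + 1)
  else ((graphLine.take (graphPos a)).drop (graphPos b + 1)).reverse

/-- `intermediate a b` really is the interior of the simple path from `a` to `b` in the graph. -/
theorem intermediate_isPath (a b : ZMod 5) (h : a ≠ b) :
    (a :: (intermediate a b ++ [b])).IsChain generatingGraph.Adj ∧
      (a :: (intermediate a b ++ [b])).Nodup := by
  have hadj : ∀ x y : ZMod 5, generatingGraph.Adj x y ↔
      ((s(x, y) = s(1, 4) ∨ s(x, y) = s(4, 3) ∨ s(x, y) = s(3, 2) ∨ s(x, y) = s(2, 5)) ∧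
        x ≠ y) := by
    intro x y
    simp [generatingGraph]
  have hrel : generatingGraph.Adj = fun x y : ZMod 5 =>
      ((s(x, y) = s(1, 4) ∨ s(x, y) = s(4, 3) ∨ s(x, y) = s(3, 2) ∨ s(x, y) = s(2, 5)) ∧
        x ≠ y) := by
    funext x y
    exact propext (hadj x y)
  rw [hrel]
  revert a b
  decide

/-- Cyclic shift of the labels of a word by `j`. -/
def shiftWord (j : ℕ) (w : List (ZMod 5)) : List (ZMod 5) := w.map (fun a => a + (j : ZMod 5))

/-- The cyclic word obtained from the cyclic word `w` by travelling along the generating graph from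
each symbol to the (cyclically) next one and inserting all the symbols passed on the way. -/
def enhance (w : List (ZMod 5)) : List (ZMod 5) :=
  (w.zip (w.rotate 1)).flatMap (fun p => p.1 :: intermediate p.1 p.2)

/-! ### The double pentagon and its closed linear trajectories

The first pentagon `P` is the regular pentagon in `ℂ` with centre `0`, inradius `1` and a horizontal
bottom side; the second one is `P' = -P`. Counterclockwise from the bottom, the sides of `P` are
labelled `1, 3, 5, 2, 4`; the side of `P'` parallel to a side of `P` has the same label, and the two
are identified by the translation. -/

/-- The midpoint of the side of `P` with label `i`: a unit vector, at the angle `54° + 216° i`. -/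
def sideMidpoint (i : ZMod 5) : ℂ :=
  Complex.exp (((3 * Real.pi / 10 + 6 * Real.pi / 5 * (i.val : ℝ) : ℝ) : ℂ) * Complex.I)

/-- A crossing of a trajectory with a side of the double pentagon: the label of the side, the
position on the side, and the pentagon that the trajectory enters there (`1` for `P`, `-1` for
`P'`). The position is the signed distance from the midpoint of the side; it lies strictly between
the two ends of the side, as trajectories do not pass through the vertices. -/
structure Crossing where
  sheet : ℤˣ
  side : ZMod 5
  param : ℝ
  abs_param_lt : |param| < Real.tan (Real.pi / 5)

/-- The place, in the plane of the pentagon `ε = 1` (for `P`) or `ε = -1` (for `P'`), of the point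
with position `s` on the side with label `i`. The identification of the two sides with label `i`
is the translation by `2 * sideMidpoint i`, so it preserves `s`. -/
def place (ε : ℤˣ) (i : ZMod 5) (s : ℝ) : ℂ :=
  (((ε : ℤ) : ℂ) + (s : ℂ) * Complex.I) * sideMidpoint i

/-- The displacement of a trajectory between two consecutive crossings `c` and `c'`, inside the
pentagon entered at `c`. -/
def displacement (c c' : Crossing) : ℂ :=
  place c.sheet c'.side c'.param - place c.sheet c.side c.param

/-- The trajectory in the direction `v` that enters a pentagon at `c` leaves it at `c'`, and thereby
enters the other pentagon. -/
def Step (v : ℂ) (c c' : Crossing) : Prop :=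
  c'.sheet = -c.sheet ∧ c'.side ≠ c.side ∧ ∃ τ : ℝ, 0 < τ ∧ displacement c c' = (τ : ℂ) * v

/-- A closed linear trajectory on the double pentagon in the direction of `v`, traversed once,
with a chosen first crossing. -/
structure ClosedTrajectory (v : ℂ) where
  /-- the number of crossings with the sides -/
  period : ℕ
  period_pos : 0 < period
  /-- the consecutive crossings with the sides -/
  crossing : ℕ → Crossing
  step : ∀ n, Step v (crossing n) (crossing (n + 1))
  closes_up : ∀ n, crossing (n + period) = crossing n
  traversed_once : ∀ m, 0 < m → m < period → crossing m ≠ crossing 0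

/-- The symbolic orbit: the labels of the consecutively crossed sides. -/
def ClosedTrajectory.word {v : ℂ} (γ : ClosedTrajectory v) : List (ZMod 5) :=
  (List.range γ.period).map (fun n => (γ.crossing n).side)

/-- The Euclidean length of a closed trajectory. -/
def ClosedTrajectory.length {v : ℂ} (γ : ClosedTrajectory v) : ℝ :=
  ∑ n ∈ Finset.range γ.period, ‖displacement (γ.crossing n) (γ.crossing (n + 1))‖

/-- `γ` is at most as long as `γ'`: its symbolic orbit has fewer symbols, or both have the same
number of symbols and `γ` has at most the Euclidean length of `γ'`. -/
def ClosedTrajectory.AtMostAsLong {v : ℂ} (γ γ' : ClosedTrajectory v) : Prop :=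
  γ.period < γ'.period ∨ (γ.period = γ'.period ∧ γ.length ≤ γ'.length)

/-! ### Directions

The circle of directions (up to sign) is identified with `ℝ ∪ {∞}`, the absolute of the hyperbolic
plane, by the projective coordinate in which the directions at the angles
`180°, 216°, 252°, 288°, 324°` (those of the sides `1, 2, 3, 4, 5`) have the coordinates
`1 - φ/2, φ/2, ∞, -φ/2, φ/2 - 1`. The principal (3rd) sector of directions, between `144°` and
`180°`, is the arc `[φ/2 - 1, 1 - φ/2]`. -/

/-- A vector in the direction with the coordinate `t`; its angle is `162° + arctan (t / sin 36°)`. -/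
def directionVector (t : ℝ) : ℂ :=
  Complex.exp (((9 * Real.pi / 10 : ℝ) : ℂ) * Complex.I) *
    ((Real.sin (Real.pi / 5) : ℂ) + (t : ℂ) * Complex.I)

/-- `w` is a short symbolic orbit of the direction with the coordinate `t`. -/
def IsShortOrbit (t : ℝ) (w : List (ZMod 5)) : Prop :=
  ∃ γ : ClosedTrajectory (directionVector t), γ.word = w ∧
    ∀ γ' : ClosedTrajectory (directionVector t), γ.AtMostAsLong γ'

/-- `w` is a long symbolic orbit of the direction with the coordinate `t`. -/
def IsLongOrbit (t : ℝ) (w : List (ZMod 5)) : Prop :=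
  ∃ γ : ClosedTrajectory (directionVector t), γ.word = w ∧
    ∀ γ' : ClosedTrajectory (directionVector t), γ'.AtMostAsLong γ

/-- The action on the absolute of the reflection of the hyperbolic plane in the geodesic with the
(distinct, finite) ends `p` and `q`: the projective involution that fixes `p` and `q`. -/
def geodesicReflection (p q x : ℝ) : ℝ :=
  ((p + q) * x - 2 * p * q) / (2 * x - (p + q))

/-- The vertices of the pentagon of the first generation over the principal sector: the reflections
of the vertices `1 - φ/2, φ/2, ∞, -φ/2, φ/2 - 1` of the pentagon of generation `0` in the geodesic
from `1 - φ/2` to `φ/2 - 1`. (This reflection is `x ↦ 1 / (4 φ⁴ x)`; it takes `∞` to `0`.) -/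
def firstPentagon : Fin 5 → ℝ :=
  ![1 - Real.goldenRatio / 2,
    geodesicReflection (1 - Real.goldenRatio / 2) (Real.goldenRatio / 2 - 1) (Real.goldenRatio / 2),
    0,
    geodesicReflection (1 - Real.goldenRatio / 2) (Real.goldenRatio / 2 - 1)
      (-(Real.goldenRatio / 2)),
    Real.goldenRatio / 2 - 1]

/-- The pentagon of the next generation obtained from the ideal pentagon with the consecutive
vertices `P 0, …, P 4` by reflection in its side from `P n` to `P (n + 1)`; its vertices are
listed from `P n` to `P (n + 1)`, along the arc under that side. -/
def nextPentagon (P : Fin 5 → ℝ) (n : ℕ) : Fin 5 → ℝ := fun i =>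
  geodesicReflection (P (Fin.ofNat 5 n)) (P (Fin.ofNat 5 n + 1)) (P (Fin.ofNat 5 n - i))

/-- The pentagon reached from the first one by passing successively through the sides with the
numbers in `l`, where the side number `n ∈ {0, 1, 2, 3}` joins the vertices number `n` and
`n + 1`. -/
def pentagon (l : List ℕ) : Fin 5 → ℝ := l.foldl nextPentagon firstPentagon

/-- The direction `α_{n₁ … n_{k-1} n}`, where `l = [n₁, …, n_{k-1}]`: the vertex number `n` of the
pentagon of generation `k` reached through the sides with the numbers `n₁, …, n_{k-1}`. Also
`alpha [] 0` is the direction `α` of generation `0`, and `alpha [] 4` is the other end of the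
principal sector. -/
def alpha (l : List ℕ) (n : ℕ) : ℝ := pentagon l (Fin.ofNat 5 n)

end DoublePentagon

end

open DoublePentagon

/-! In a fixed direction a crossing is determined by its side and its transverse offset from the
midpoint. A trajectory is therefore a walk in a `LinearFlow`, whose data are the signed half-widths
and the positions of the five sides seen along the flow. Closed trajectories become cycles, and up
to a constant factor the length becomes the weight, the total width of the sides met.

In the principal sector the walk moves only between neighbours on the path 1-4-3-2-5. Reflecting the
direction in the boundary of the sector changes the sign of `y` in `sectorFlow x y`. The states
admitted by the reflected flow are exactly the turning points of the walk (`turn_cases`), and up to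
the sign of the offset consecutive turning points follow each other in that flow
(`Cycle.next_turn`). So passing from a cycle of the reflected flow to one of the principal flow
means inserting the vertices between turning points, which is `enhance`. Summation by parts shows
that weights are multiplied by one constant (`renormalizes_enhance`).

A cyclic shift of labels by `j` carries the principal sector to another one (`similar_rotation`).
Shift, reflection and rescaling together act on the coordinate as the map `sectorMap j`
(`renormalizes_sectorMap`). This map is fractional linear and reverses order, so it commutes with
geodesic reflections and carries the tree of ideal pentagons under the first one to a subtree. Order
reversal replaces side `n` by `3 - n` and vertex `n` by `4 - n`, which gives the direction in the
theorem (`alpha_cons`).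

It remains to reconcile the ordering by number of symbols with the ordering by weight. In the
direction `α` the surface splits into two cylinders whose weights have ratio `φ`, and
renormalization preserves this ratio. Counting edges of the walk and using the irrationality of `φ`,
one finds that a larger weight never has a smaller period (`Cycle.period_le_period`). Hence short
and long orbits are the cycles of least and greatest weight, and these are transported by
`Renormalizes`. -/

noncomputable section

namespace DoublePentagon

open scoped goldenRatio

/-! ### Linear flows and their cycles -/

/-- The combinatorial data of a linear flow on the double pentagon: for each side, its half-width
`|width i|` transversally to the flow (the sign tells which pentagon is entered through the side),
and the transverse position of its midpoint. -/
structure LinearFlow where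
  width : ZMod 5 → ℝ
  position : ZMod 5 → ℝ

namespace LinearFlow

/-- A state of a flow consists of a side and of a transverse offset from its midpoint; the flow
admits the states which lie strictly between the ends of the side. -/
def Admits (D : LinearFlow) (c : ZMod 5 × ℝ) : Prop := |c.2| < |D.width c.1|

/-- The state `c'` follows `c`. -/
def Next (D : LinearFlow) (c c' : ZMod 5 × ℝ) : Prop :=
  (D.width c.1 < 0 ∧ 0 < D.width c'.1 ∧ c'.2 = c.2 + (D.position c.1 - D.position c'.1)) ∨
  (0 < D.width c.1 ∧ D.width c'.1 < 0 ∧ c'.2 = c.2 - (D.position c.1 - D.position c'.1))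

/-- A closed orbit of the flow, traversed once. -/
structure Cycle (D : LinearFlow) where
  period : ℕ
  period_pos : 0 < period
  state : ℕ → ZMod 5 × ℝ
  admits : ∀ n, D.Admits (state n)
  next : ∀ n, D.Next (state n) (state (n + 1))
  closes_up : ∀ n, state (n + period) = state n
  traversed_once : ∀ m, 0 < m → m < period → state m ≠ state 0

variable {D E G : LinearFlow}

/-- The sides met by a cycle. -/
def Cycle.word (o : Cycle D) : List (ZMod 5) :=
  (List.range o.period).map (fun n => (o.state n).1)

/-- The total width of the sides met by a cycle. -/
def Cycle.weight (o : Cycle D) : ℝ :=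
  ∑ n ∈ Finset.range o.period, |D.width (o.state n).1|

theorem Cycle.length_word (o : Cycle D) : o.word.length = o.period := by
  simp [Cycle.word]

theorem Cycle.weight_pos (o : Cycle D) : 0 < o.weight := by
  refine Finset.sum_pos (fun n _ => ?_) ⟨0, Finset.mem_range.2 o.period_pos⟩
  exact (abs_nonneg _).trans_lt (o.admits n)

theorem Cycle.sum_range_succ_period (o : Cycle D) (f : ZMod 5 × ℝ → ℝ) :
    ∑ n ∈ Finset.range o.period, f (o.state (n + 1)) =
      ∑ n ∈ Finset.range o.period, f (o.state n) := by
  have h := Finset.sum_range_sub (fun n => f (o.state n)) o.period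
  have h0 : o.state o.period = o.state 0 := by simpa using o.closes_up 0
  rw [Finset.sum_sub_distrib, h0, sub_self] at h
  exact sub_eq_zero.1 h

theorem Cycle.sum_range_succ_sub (o : Cycle D) (f : ℕ → ℝ) (hf : f o.period = f 0) :
    ∑ n ∈ Finset.range o.period, (f (n + 1) - f n) = 0 := by
  rw [Finset.sum_range_sub, hf, sub_self]

/-- An injective map of states that respects the flows carries cycles to cycles. -/
def Cycle.map (o : Cycle D) (F : ZMod 5 × ℝ → ZMod 5 × ℝ) (hF : Function.Injective F)
    (hA : ∀ c, D.Admits c → E.Admits (F c)) (hN : ∀ c c', D.Next c c' → E.Next (F c) (F c')) :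
    Cycle E where
  period := o.period
  period_pos := o.period_pos
  state n := F (o.state n)
  admits n := hA _ (o.admits n)
  next n := hN _ _ (o.next n)
  closes_up n := by rw [o.closes_up]
  traversed_once m h0 h1 h := o.traversed_once m h0 h1 (hF h)

/-- The cycles of `D` correspond to those of `E`, up to the choice of the first state; words are
transformed by `f`, and weights are multiplied by a constant. -/
def Renormalizes (D E : LinearFlow) (f : List (ZMod 5) → List (ZMod 5)) : Prop :=
  ∃ κ : ℝ, 0 < κ ∧
    (∀ o : Cycle D, ∃ o' : Cycle E, o'.word = f o.word ∧ o'.weight = κ * o.weight) ∧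
    (∀ o' : Cycle E, ∃ o : Cycle D, o'.weight = κ * o.weight)

/-- `w` is the word of a cycle with the least weight. -/
def IsLeastWord (D : LinearFlow) (w : List (ZMod 5)) : Prop :=
  ∃ o : Cycle D, o.word = w ∧ ∀ o' : Cycle D, o.weight ≤ o'.weight

/-- `w` is the word of a cycle with the greatest weight. -/
def IsGreatestWord (D : LinearFlow) (w : List (ZMod 5)) : Prop :=
  ∃ o : Cycle D, o.word = w ∧ ∀ o' : Cycle D, o'.weight ≤ o.weight

/-- Different weights of cycles have the ratio `φ`. -/
def HasGoldenWeights (D : LinearFlow) : Prop :=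
  ∀ o o' : Cycle D, o.weight ≤ o'.weight → o'.weight = o.weight ∨ o'.weight = φ * o.weight

namespace Renormalizes

variable {f g : List (ZMod 5) → List (ZMod 5)}

theorem trans (h : Renormalizes D E f) (h' : Renormalizes E G g) :
    Renormalizes D G (fun w => g (f w)) := by
  obtain ⟨κ, hκ, h1, h2⟩ := h
  obtain ⟨κ', hκ', h1', h2'⟩ := h'
  refine ⟨κ' * κ, by positivity, fun o => ?_, fun o' => ?_⟩
  · obtain ⟨o1, hw1, hl1⟩ := h1 o
    obtain ⟨o2, hw2, hl2⟩ := h1' o1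
    exact ⟨o2, by rw [hw2, hw1], by rw [hl2, hl1]; ring⟩
  · obtain ⟨o1, hl1⟩ := h2' o'
    obtain ⟨o2, hl2⟩ := h2 o1
    exact ⟨o2, by rw [hl1, hl2]; ring⟩

theorem isLeastWord (h : Renormalizes D E f) {w : List (ZMod 5)} (hw : D.IsLeastWord w) :
    E.IsLeastWord (f w) := by
  obtain ⟨κ, hκ, h1, h2⟩ := h
  obtain ⟨o, rfl, ho⟩ := hw
  obtain ⟨o', hw', hl'⟩ := h1 o
  refine ⟨o', hw', fun o2 => ?_⟩
  obtain ⟨o1, hl1⟩ := h2 o2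
  rw [hl', hl1]
  exact mul_le_mul_of_nonneg_left (ho o1) hκ.le

theorem isGreatestWord (h : Renormalizes D E f) {w : List (ZMod 5)} (hw : D.IsGreatestWord w) :
    E.IsGreatestWord (f w) := by
  obtain ⟨κ, hκ, h1, h2⟩ := h
  obtain ⟨o, rfl, ho⟩ := hw
  obtain ⟨o', hw', hl'⟩ := h1 o
  refine ⟨o', hw', fun o2 => ?_⟩
  obtain ⟨o1, hl1⟩ := h2 o2
  rw [hl', hl1]
  exact mul_le_mul_of_nonneg_left (ho o1) hκ.le

theorem hasGoldenWeights (h : Renormalizes D E f) (hD : D.HasGoldenWeights) :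
    E.HasGoldenWeights := by
  obtain ⟨κ, hκ, -, h2⟩ := h
  intro o o' hle
  obtain ⟨o1, h1⟩ := h2 o
  obtain ⟨o2, h2⟩ := h2 o'
  rw [h1, h2] at hle ⊢
  rcases hD o1 o2 (le_of_mul_le_mul_left hle hκ) with h | h
  · left; rw [h]
  · right; rw [h]; ring

end Renormalizes

/-- The data of `E` are those of `D` after a cyclic shift of the labels by `j`, up to a real
factor, and up to a translation of the transverse coordinate. -/
def Similar (j : ZMod 5) (D E : LinearFlow) : Prop :=
  ∃ k : ℝ, k ≠ 0 ∧ ∃ d : ℝ, ∀ i, E.width (i + j) = k * D.width i ∧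
    E.position (i + j) = k * D.position i + d

namespace Similar

variable {j : ZMod 5}

theorem inverse_data {k d : ℝ} (hk : k ≠ 0) (h : ∀ i, E.width (i + j) = k * D.width i ∧
    E.position (i + j) = k * D.position i + d) (i : ZMod 5) :
    D.width (i + -j) = k⁻¹ * E.width i ∧
      D.position (i + -j) = k⁻¹ * E.position i + -(k⁻¹ * d) := by
  have h1 := (h (i + -j)).1
  have h2 := (h (i + -j)).2
  rw [neg_add_cancel_right] at h1 h2
  rw [h1, h2]
  constructor <;> field_simp
  ring

theorem exists_cycle {k d : ℝ} (hk : k ≠ 0) (h : ∀ i, E.width (i + j) = k * D.width i ∧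
    E.position (i + j) = k * D.position i + d) (o : Cycle D) :
    ∃ o' : Cycle E,
      o'.word = o.word.map (fun a => a + j) ∧ o'.weight = |k| * o.weight := by
  have hk' : 0 < |k| := abs_pos.2 hk
  refine ⟨o.map (fun c => (c.1 + j, |k| * c.2)) ?_ ?_ ?_, ?_, ?_⟩
  · rintro ⟨i, u⟩ ⟨i', u'⟩ hh
    simp only [Prod.mk.injEq, add_left_inj, mul_eq_mul_left_iff, hk'.ne', or_false] at hh
    exact Prod.ext hh.1 hh.2
  · intro c hc
    simp only [Admits, (h _).1, abs_mul, abs_abs] at hc ⊢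
    exact mul_lt_mul_of_pos_left hc hk'
  · intro c c' hc
    simp only [Next, (h _).1, (h _).2] at hc ⊢
    -- A negative factor changes all signs of the widths, that is, exchanges the two pentagons and
    -- with them the two alternatives of `Next`. This is why offsets are multiplied by `|k|` and not
    -- by `k`.
    rcases lt_or_gt_of_ne hk with hk0 | hk0
    · rw [abs_of_neg hk0]
      rcases hc with ⟨h1, h2, h3⟩ | ⟨h1, h2, h3⟩
      · exact Or.inr ⟨mul_pos_of_neg_of_neg hk0 h1, mul_neg_of_neg_of_pos hk0 h2,
          by rw [h3]; ring⟩
      · exact Or.inl ⟨mul_neg_of_neg_of_pos hk0 h1, mul_pos_of_neg_of_neg hk0 h2,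
          by rw [h3]; ring⟩
    · rw [abs_of_pos hk0]
      rcases hc with ⟨h1, h2, h3⟩ | ⟨h1, h2, h3⟩
      · exact Or.inl ⟨mul_neg_of_pos_of_neg hk0 h1, mul_pos hk0 h2, by rw [h3]; ring⟩
      · exact Or.inr ⟨mul_pos hk0 h1, mul_neg_of_pos_of_neg hk0 h2, by rw [h3]; ring⟩
  · simp [Cycle.word, Cycle.map]
  · simp [Cycle.weight, Cycle.map, (h _).1, abs_mul, Finset.mul_sum]

theorem renormalizes {n : ℕ} (h : Similar (n : ZMod 5) D E) :
    Renormalizes D E (shiftWord n) := by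
  obtain ⟨k, hk, d, h⟩ := h
  refine ⟨|k|, abs_pos.2 hk, exists_cycle hk h, fun o' => ?_⟩
  obtain ⟨o, -, ho⟩ := exists_cycle (inv_ne_zero hk) (inverse_data hk h) o'
  refine ⟨o, ?_⟩
  rw [ho, abs_inv, mul_inv_cancel_left₀ (abs_pos.2 hk).ne']

end Similar

/-! ### The flows in the principal sector -/

/-- The flow in the direction in which the sides `1` and `5` have the half-widths `x` and `y`.
The principal sector is given by `0 ≤ x` and `0 ≤ y`. -/
def sectorFlow (x y : ℝ) : LinearFlow where
  width i := (![-y, -x, φ * x + y, -(φ * x + φ * y), x + φ * y] : Fin 5 → ℝ) i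
  position i := (![(2 * φ + 1) * (x + y), 0, (φ + 1) * x + (2 * φ + 1) * y, (φ + 1) * x + φ * y,
    φ * y] : Fin 5 → ℝ) i

section simps
variable (x y : ℝ)
@[simp] theorem sectorFlow_width_zero : (sectorFlow x y).width 0 = -y := rfl
@[simp] theorem sectorFlow_width_one : (sectorFlow x y).width 1 = -x := rfl
@[simp] theorem sectorFlow_width_two : (sectorFlow x y).width 2 = φ * x + y := rfl
@[simp] theorem sectorFlow_width_three : (sectorFlow x y).width 3 = -(φ * x + φ * y) := rfl
@[simp] theorem sectorFlow_width_four : (sectorFlow x y).width 4 = x + φ * y := rfl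
@[simp] theorem sectorFlow_position_zero :
    (sectorFlow x y).position 0 = (2 * φ + 1) * (x + y) := rfl
@[simp] theorem sectorFlow_position_one : (sectorFlow x y).position 1 = 0 := rfl
@[simp] theorem sectorFlow_position_two :
    (sectorFlow x y).position 2 = (φ + 1) * x + (2 * φ + 1) * y := rfl
@[simp] theorem sectorFlow_position_three :
    (sectorFlow x y).position 3 = (φ + 1) * x + φ * y := rfl
@[simp] theorem sectorFlow_position_four : (sectorFlow x y).position 4 = φ * y := rfl
end simps

theorem side_cases (i : ZMod 5) : i = 0 ∨ i = 1 ∨ i = 2 ∨ i = 3 ∨ i = 4 := by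
  revert i; decide

theorem goldenRatio_gt : (8 / 5 : ℝ) < φ := by
  have h := Real.goldenRatio_sq
  have h1 := Real.one_lt_goldenRatio
  nlinarith

theorem goldenRatio_lt : φ < (5 / 3 : ℝ) := by
  have h := Real.goldenRatio_sq
  have h1 := Real.one_lt_goldenRatio
  nlinarith

/-- The side `a` is followed by the side `b` in a step of `sectorFlow x y` between the offsets `u`
and `u'`, whose endpoints are neighbours on the path `1 - 4 - 3 - 2 - 5`. -/
inductive SectorStep (x y : ℝ) : ZMod 5 × ℝ → ZMod 5 × ℝ → Prop
  | step14 {c c'} : c.1 = 1 → c'.1 = 4 → c'.2 = c.2 - φ * y → SectorStep x y c c'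
  | step41 {c c'} : c.1 = 4 → c'.1 = 1 → c'.2 = c.2 - φ * y → SectorStep x y c c'
  | step43 {c c'} : c.1 = 4 → c'.1 = 3 → c'.2 = c.2 + (φ + 1) * x → SectorStep x y c c'
  | step34 {c c'} : c.1 = 3 → c'.1 = 4 → c'.2 = c.2 + (φ + 1) * x → SectorStep x y c c'
  | step32 {c c'} : c.1 = 3 → c'.1 = 2 → c'.2 = c.2 - (φ + 1) * y → SectorStep x y c c'
  | step23 {c c'} : c.1 = 2 → c'.1 = 3 → c'.2 = c.2 - (φ + 1) * y → SectorStep x y c c'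
  | step20 {c c'} : c.1 = 2 → c'.1 = 0 → c'.2 = c.2 + φ * x → SectorStep x y c c'
  | step02 {c c'} : c.1 = 0 → c'.1 = 2 → c'.2 = c.2 + φ * x → SectorStep x y c c'

variable {x y : ℝ}

/-- The signs of the widths alternate along the path, so a step joins vertices at odd distance. The
two pairs at distance three, 1 with 2 and 4 with 5, are excluded because their transverse shadows at
most touch. -/
theorem sectorStep_of_next (hx : 0 ≤ x) (hy : 0 ≤ y) {c c' : ZMod 5 × ℝ}
    (hc : (sectorFlow x y).Admits c) (hc' : (sectorFlow x y).Admits c')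
    (h : (sectorFlow x y).Next c c') : SectorStep x y c c' := by
  obtain ⟨i, u⟩ := c
  obtain ⟨j, u'⟩ := c'
  have hφ := goldenRatio_gt
  have hφx : 0 ≤ φ * x := by positivity
  have hφy : 0 ≤ φ * y := by positivity
  have h2 : 0 ≤ φ * x + y := by positivity
  have h3 : 0 ≤ φ * x + φ * y := by positivity
  have h4 : 0 ≤ x + φ * y := by positivity
  simp only [Admits, abs_lt] at hc hc'
  unfold Next at h
  dsimp only at h
  rcases side_cases i with rfl | rfl | rfl | rfl | rfl <;>
  rcases side_cases j with rfl | rfl | rfl | rfl | rfl <;>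
  simp only [sectorFlow_width_zero, sectorFlow_width_one, sectorFlow_width_two,
    sectorFlow_width_three, sectorFlow_width_four, sectorFlow_position_zero,
    sectorFlow_position_one, sectorFlow_position_two, sectorFlow_position_three,
    sectorFlow_position_four, abs_neg, abs_of_nonneg hx, abs_of_nonneg hy, abs_of_nonneg h2,
    abs_of_nonneg h3, abs_of_nonneg h4] at h hc hc' <;>
  rcases h with ⟨h1, h2, h3⟩ | ⟨h1, h2, h3⟩ <;>
  first
  | (exfalso; linarith)
  | exact .step14 rfl rfl (by dsimp only; linarith)
  | exact .step41 rfl rfl (by dsimp only; linarith)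
  | exact .step43 rfl rfl (by dsimp only; linarith)
  | exact .step34 rfl rfl (by dsimp only; linarith)
  | exact .step32 rfl rfl (by dsimp only; linarith)
  | exact .step23 rfl rfl (by dsimp only; linarith)
  | exact .step20 rfl rfl (by dsimp only; linarith)
  | exact .step02 rfl rfl (by dsimp only; linarith)

theorem Cycle.sectorStep (hx : 0 ≤ x) (hy : 0 ≤ y) (o : Cycle (sectorFlow x y)) (n : ℕ) :
    SectorStep x y (o.state n) (o.state (n + 1)) :=
  sectorStep_of_next hx hy (o.admits n) (o.admits (n + 1)) (o.next n)

/-! ### Edge counts, weights and periods -/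

/-- The numbers of times that the first `N` steps of a cycle run along the four edges of the path
`1 - 4 - 3 - 2 - 5`. -/
theorem Cycle.exists_edge_counts (hx : 0 ≤ x) (hy : 0 ≤ y) (o : Cycle (sectorFlow x y)) (N : ℕ) :
    ∃ a b c d : ℕ, N = a + b + c + d ∧
      (o.state N).2 - (o.state 0).2 = φ * (x * (d + φ * b) - y * (a + φ * c)) ∧
      ∑ n ∈ Finset.range N, (|(sectorFlow x y).width (o.state n).1| +
        |(sectorFlow x y).width (o.state (n + 1)).1|) =
        (2 * x + φ * y) * (a + φ * c) + (φ * x + 2 * y) * (d + φ * b) := by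
  have hφ := goldenRatio_gt
  have hsq := Real.goldenRatio_sq
  have h0 : 0 ≤ φ * x + y := by positivity
  have h1 : 0 ≤ φ * x + φ * y := by positivity
  have h2 : 0 ≤ x + φ * y := by positivity
  induction N with
  | zero => exact ⟨0, 0, 0, 0, by simp⟩
  | succ N ih =>
    obtain ⟨a, b, c, d, hN, hu, hs⟩ := ih
    rw [Finset.sum_range_succ, hs]
    rcases o.sectorStep hx hy N with ⟨e1, e2, e3⟩ | ⟨e1, e2, e3⟩ | ⟨e1, e2, e3⟩ | ⟨e1, e2, e3⟩ |
      ⟨e1, e2, e3⟩ | ⟨e1, e2, e3⟩ | ⟨e1, e2, e3⟩ | ⟨e1, e2, e3⟩ <;>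
    rw [e1, e2, e3] <;>
    simp only [sectorFlow_width_zero, sectorFlow_width_one, sectorFlow_width_two,
      sectorFlow_width_three, sectorFlow_width_four, abs_neg, abs_of_nonneg hx, abs_of_nonneg hy,
      abs_of_nonneg h0, abs_of_nonneg h1, abs_of_nonneg h2]
    · exact ⟨a + 1, b, c, d, by omega, by push_cast; linear_combination hu,
        by push_cast; ring⟩
    · exact ⟨a + 1, b, c, d, by omega, by push_cast; linear_combination hu,
        by push_cast; ring⟩
    · exact ⟨a, b + 1, c, d, by omega, by push_cast; linear_combination hu - x * hsq,
        by push_cast; linear_combination -x * hsq⟩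
    · exact ⟨a, b + 1, c, d, by omega, by push_cast; linear_combination hu - x * hsq,
        by push_cast; linear_combination -x * hsq⟩
    · exact ⟨a, b, c + 1, d, by omega, by push_cast; linear_combination hu + y * hsq,
        by push_cast; linear_combination -y * hsq⟩
    · exact ⟨a, b, c + 1, d, by omega, by push_cast; linear_combination hu + y * hsq,
        by push_cast; linear_combination -y * hsq⟩
    · exact ⟨a, b, c, d + 1, by omega, by push_cast; linear_combination hu,
        by push_cast; ring⟩
    · exact ⟨a, b, c, d + 1, by omega, by push_cast; linear_combination hu,
        by push_cast; ring⟩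

/-- Closing up makes the total change of offset vanish, and the sum of widths over both ends of
every step is twice the weight. These are two linear equations for `a + φ * c` and `d + φ * b`; up
to the factor `-2` their determinant is `x ^ 2 + φ * x * y + y ^ 2`. -/
theorem Cycle.exists_period_eq (hx : 0 ≤ x) (hy : 0 ≤ y) (o : Cycle (sectorFlow x y)) :
    ∃ a b c d : ℕ, o.period = a + b + c + d ∧
      (a + φ * c) * (x ^ 2 + φ * x * y + y ^ 2) = x * o.weight ∧
      (d + φ * b) * (x ^ 2 + φ * x * y + y ^ 2) = y * o.weight := by
  obtain ⟨a, b, c, d, hN, hu, hs⟩ := o.exists_edge_counts hx hy o.period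
  have h0 : o.state o.period = o.state 0 := by simpa using o.closes_up 0
  rw [h0, sub_self] at hu
  have h1 : x * (d + φ * b) - y * (a + φ * c) = 0 :=
    (mul_eq_zero.1 hu.symm).resolve_left Real.goldenRatio_ne_zero
  rw [Finset.sum_add_distrib,
    o.sum_range_succ_period (fun c => |(sectorFlow x y).width c.1|)] at hs
  change o.weight + o.weight = _ at hs
  refine ⟨a, b, c, d, hN, ?_, ?_⟩
  · linear_combination (-(x / 2)) * hs - (φ * x / 2 + y) * h1
  · linear_combination (-(y / 2)) * hs + (x + φ * y / 2) * h1

theorem natCast_add_goldenRatio_mul_inj {a b c d : ℕ} (h : (a + φ * b : ℝ) = c + φ * d) :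
    a = c ∧ b = d := by
  have hbd : b = d := by
    by_contra hne
    have hne' : (b : ℝ) - d ≠ 0 := sub_ne_zero.2 (by exact_mod_cast hne)
    refine Real.goldenRatio_irrational ⟨((c : ℚ) - a) / (b - d), ?_⟩
    push_cast
    rw [div_eq_iff hne']
    linear_combination -h
  subst hbd
  exact ⟨by exact_mod_cast add_right_cancel h, rfl⟩

/-- In a flow with golden weights the cycles are ordered in the same way by the weights and by the
periods. -/
theorem Cycle.period_le_period (hx : 0 ≤ x) (hy : 0 ≤ y) (hxy : 0 < x + y)
    (hD : (sectorFlow x y).HasGoldenWeights) (o o' : Cycle (sectorFlow x y))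
    (h : o.weight ≤ o'.weight) : o.period ≤ o'.period := by
  obtain ⟨a, b, c, d, hN, h1, h2⟩ := o.exists_period_eq hx hy
  obtain ⟨a', b', c', d', hN', h1', h2'⟩ := o'.exists_period_eq hx hy
  have hsq := Real.goldenRatio_sq
  have hφ := goldenRatio_gt
  have hQ : x ^ 2 + φ * x * y + y ^ 2 ≠ 0 := by
    have : 0 ≤ (φ - 8 / 5) * (x * y) := mul_nonneg (by linarith) (by positivity)
    nlinarith [mul_pos hxy hxy, mul_nonneg hx hy, sq_nonneg (x - y)]
  rcases hD o o' h with hw | hw <;> rw [hw] at h1' h2'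
  · have e1 := natCast_add_goldenRatio_mul_inj (mul_right_cancel₀ hQ (h1.trans h1'.symm))
    have e2 := natCast_add_goldenRatio_mul_inj (mul_right_cancel₀ hQ (h2.trans h2'.symm))
    omega
  -- Since `φ * (a + φ * c) = c + φ * (a + c)`, irrationality forces `a' = c` and `c' = a + c`, and
  -- likewise for the other pair. The period grows by `b + c`.
  · have e1 : ((c : ℕ) + φ * ((a + c : ℕ) : ℝ) : ℝ) = a' + φ * c' := by
      refine mul_right_cancel₀ hQ ?_
      rw [h1']
      push_cast
      linear_combination φ * h1 - c * (x ^ 2 + φ * x * y + y ^ 2) * hsq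
    have e2 : ((b : ℕ) + φ * ((d + b : ℕ) : ℝ) : ℝ) = d' + φ * b' := by
      refine mul_right_cancel₀ hQ ?_
      rw [h2']
      push_cast
      linear_combination φ * h2 - b * (x ^ 2 + φ * x * y + y ^ 2) * hsq
    have e1 := natCast_add_goldenRatio_mul_inj e1
    have e2 := natCast_add_goldenRatio_mul_inj e2
    omega

/-- A cycle that returns to its first state after two steps has period `2`. -/
theorem Cycle.period_eq_two {D : LinearFlow} (o : Cycle D) (h : o.state 2 = o.state 0) :
    o.period = 2 := by
  have h1 : o.period ≠ 1 := by
    intro h1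
    have h2 : o.state (0 + 1) = o.state 0 := h1 ▸ o.closes_up 0
    rcases h2 ▸ o.next 0 with ⟨h3, h4, -⟩ | ⟨h3, h4, -⟩ <;> exact lt_asymm h3 h4
  have h2 := o.period_pos
  by_contra h3
  exact o.traversed_once 2 two_pos (by omega) h

/-- For `x = 0` side 1 has width zero, and the shadows of sides 3 and 2 only touch. What is left are
the two cylinders, in which the walk alternates between 3 and 4 or between 2 and 5 with a constant
offset. -/
theorem Cycle.weight_eq_of_left_eq_zero (hy : 0 ≤ y) (o : Cycle (sectorFlow 0 y)) :
    o.weight = 2 * y ∨ o.weight = φ * (2 * y) := by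
  have hφ := goldenRatio_gt
  have hφy : 0 ≤ φ * y := by positivity
  have ha0 := o.admits 0
  have ha1 := o.admits 1
  have ha2 := o.admits 2
  have hs0 := o.sectorStep le_rfl hy 0
  have hs1 := o.sectorStep le_rfl hy 1
  norm_num at hs0 hs1
  have hw : o.period = 2 → o.weight =
      |(sectorFlow 0 y).width (o.state 0).1| + |(sectorFlow 0 y).width (o.state 1).1| := by
    intro h
    rw [Cycle.weight, h, Finset.sum_range_succ, Finset.sum_range_one]
  have h2 := o.period_eq_two
  generalize o.state 0 = c0 at *
  generalize o.state 1 = c1 at *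
  generalize o.state 2 = c2 at *
  obtain ⟨i0, u0⟩ := c0
  obtain ⟨i1, u1⟩ := c1
  obtain ⟨i2, u2⟩ := c2
  simp only [Admits, abs_lt] at ha0 ha1 ha2
  rcases hs0 with ⟨e1, e2, e3⟩ | ⟨e1, e2, e3⟩ | ⟨e1, e2, e3⟩ | ⟨e1, e2, e3⟩ |
      ⟨e1, e2, e3⟩ | ⟨e1, e2, e3⟩ | ⟨e1, e2, e3⟩ | ⟨e1, e2, e3⟩ <;>
  dsimp only at e1 e2 e3 <;> subst e1 e2 e3 <;>
  rcases hs1 with ⟨e1, e2, e3⟩ | ⟨e1, e2, e3⟩ | ⟨e1, e2, e3⟩ | ⟨e1, e2, e3⟩ |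
      ⟨e1, e2, e3⟩ | ⟨e1, e2, e3⟩ | ⟨e1, e2, e3⟩ | ⟨e1, e2, e3⟩ <;>
  dsimp only at e1 e2 e3 <;>
  first
  | exact absurd e1 (by decide)
  | (subst e2 e3
     simp only [sectorFlow_width_zero, sectorFlow_width_one, sectorFlow_width_two,
      sectorFlow_width_three, sectorFlow_width_four, abs_neg, mul_zero, zero_add, add_zero,
      abs_zero, abs_of_nonneg hy, abs_of_nonneg hφy] at ha0 ha1 ha2 hw h2
     first
     | (exfalso; linarith [ha0.1, ha0.2, ha1.1, ha1.2, ha2.1, ha2.2])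
     | (rw [hw (h2 trivial)]
        first
        | (left; ring1)
        | (right; ring1)))

theorem hasGoldenWeights_sectorFlow_zero (hy : 0 ≤ y) : (sectorFlow 0 y).HasGoldenWeights := by
  intro o o' h
  have hφ := goldenRatio_gt
  rcases o.weight_eq_of_left_eq_zero hy with h1 | h1 <;>
  rcases o'.weight_eq_of_left_eq_zero hy with h2 | h2 <;> rw [h1, h2] at h ⊢
  · exact Or.inl rfl
  · exact Or.inr rfl
  · left
    nlinarith
  · exact Or.inl rfl

/-! ### Walks on the generating graph and their turning points -/

/-- The step from `c` to `c'` goes forward along the path `1 - 4 - 3 - 2 - 5`. -/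
def Ascends (c c' : ZMod 5 × ℝ) : Prop := graphPos c.1 < graphPos c'.1

/-- The sign of a step along the path. -/
def stepSign (c c' : ZMod 5 × ℝ) : ℝ := if graphPos c.1 < graphPos c'.1 then 1 else -1

theorem stepSign_of_ascends {c c' : ZMod 5 × ℝ} (h : Ascends c c') : stepSign c c' = 1 :=
  if_pos h

theorem stepSign_of_not_ascends {c c' : ZMod 5 × ℝ} (h : ¬ Ascends c c') : stepSign c c' = -1 :=
  if_neg h

/-- This is where the reflected flow appears: its positions measure the drift of the offset. The
difference of offset and position is constant on ascending runs, and their sum on descending runs.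
-/
theorem SectorStep.offset_sub {c c' : ZMod 5 × ℝ} (h : SectorStep x y c c') :
    (Ascends c c' ∧ c'.2 - c.2 =
      (sectorFlow x (-y)).position c'.1 - (sectorFlow x (-y)).position c.1) ∨
    (¬ Ascends c c' ∧ c'.2 - c.2 =
      (sectorFlow x (-y)).position c.1 - (sectorFlow x (-y)).position c'.1) := by
  unfold Ascends
  rcases h with ⟨e1, e2, e3⟩ | ⟨e1, e2, e3⟩ | ⟨e1, e2, e3⟩ | ⟨e1, e2, e3⟩ |
      ⟨e1, e2, e3⟩ | ⟨e1, e2, e3⟩ | ⟨e1, e2, e3⟩ | ⟨e1, e2, e3⟩ <;>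
  rw [e1, e2, e3] <;>
  simp only [sectorFlow_position_zero, sectorFlow_position_one, sectorFlow_position_two,
    sectorFlow_position_three, sectorFlow_position_four] <;>
  first
  | exact Or.inl ⟨by decide, by ring1⟩
  | exact Or.inr ⟨by decide, by ring1⟩

/-- Prepares a summation by parts: around a cycle the last term telescopes, and in the first one the
differences of reflected widths can be traded for changes of the step sign. The two quadratic forms
are, up to a common factor, the squared norms of the two direction vectors. -/
theorem SectorStep.width_add_width (hx : 0 ≤ x) (hy : 0 ≤ y) {c c' : ZMod 5 × ℝ}
    (h : SectorStep x y c c') :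
    (x ^ 2 - φ * x * y + y ^ 2) *
      (|(sectorFlow x y).width c.1| + |(sectorFlow x y).width c'.1|) =
    (x ^ 2 + φ * x * y + y ^ 2) * (stepSign c c' *
      ((sectorFlow x (-y)).width c'.1 - (sectorFlow x (-y)).width c.1)) +
      2 * (x ^ 2 - y ^ 2) * (c'.2 - c.2) := by
  have hφ := goldenRatio_gt
  have hsq := Real.goldenRatio_sq
  have h0 : 0 ≤ φ * x + y := by positivity
  have h1 : 0 ≤ φ * x + φ * y := by positivity
  have h2 : 0 ≤ x + φ * y := by positivity
  rcases h with ⟨e1, e2, e3⟩ | ⟨e1, e2, e3⟩ | ⟨e1, e2, e3⟩ | ⟨e1, e2, e3⟩ |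
      ⟨e1, e2, e3⟩ | ⟨e1, e2, e3⟩ | ⟨e1, e2, e3⟩ | ⟨e1, e2, e3⟩ <;>
  first
  | (rw [stepSign_of_ascends (show graphPos c.1 < graphPos c'.1 by rw [e1, e2]; decide)]
     rw [e1, e2, e3]
     simp only [sectorFlow_width_zero, sectorFlow_width_one, sectorFlow_width_two,
      sectorFlow_width_three, sectorFlow_width_four, abs_neg, abs_of_nonneg hx, abs_of_nonneg hy,
      abs_of_nonneg h0, abs_of_nonneg h1, abs_of_nonneg h2]
     first
     | ring1
     | linear_combination (4 * x * y ^ 2) * hsq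
     | linear_combination (-4 * x * y ^ 2) * hsq
     | linear_combination (4 * x ^ 2 * y) * hsq
     | linear_combination (-4 * x ^ 2 * y) * hsq)
  | (rw [stepSign_of_not_ascends (show ¬ graphPos c.1 < graphPos c'.1 by rw [e1, e2]; decide)]
     rw [e1, e2, e3]
     simp only [sectorFlow_width_zero, sectorFlow_width_one, sectorFlow_width_two,
      sectorFlow_width_three, sectorFlow_width_four, abs_neg, abs_of_nonneg hx, abs_of_nonneg hy,
      abs_of_nonneg h0, abs_of_nonneg h1, abs_of_nonneg h2]
     first
     | ring1
     | linear_combination (4 * x * y ^ 2) * hsq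
     | linear_combination (-4 * x * y ^ 2) * hsq
     | linear_combination (4 * x ^ 2 * y) * hsq
     | linear_combination (-4 * x ^ 2 * y) * hsq)

/-- A walk turns exactly at the states that are admitted by the reflected flow; the sign of the
width in that flow tells whether it turns at a local minimum or at a local maximum. -/
theorem turn_cases (hx : 0 ≤ x) (hy : 0 ≤ y) {c₀ c c₁ : ZMod 5 × ℝ}
    (ha₀ : (sectorFlow x y).Admits c₀) (ha : (sectorFlow x y).Admits c)
    (ha₁ : (sectorFlow x y).Admits c₁) (h₀ : SectorStep x y c₀ c) (h₁ : SectorStep x y c c₁) :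
    (Ascends c₀ c ∧ Ascends c c₁ ∧ ¬ (sectorFlow x (-y)).Admits c) ∨
    (¬ Ascends c₀ c ∧ ¬ Ascends c c₁ ∧ ¬ (sectorFlow x (-y)).Admits c) ∨
    (Ascends c₀ c ∧ ¬ Ascends c c₁ ∧ (sectorFlow x (-y)).Admits c ∧
      0 < (sectorFlow x (-y)).width c.1) ∨
    (¬ Ascends c₀ c ∧ Ascends c c₁ ∧ (sectorFlow x (-y)).Admits c ∧
      (sectorFlow x (-y)).width c.1 < 0) := by
  have hφ := goldenRatio_gt
  have h0 : 0 ≤ φ * x + y := by positivity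
  have h1 : 0 ≤ φ * x + φ * y := by positivity
  have h2 : 0 ≤ x + φ * y := by positivity
  unfold Ascends
  unfold Admits at *
  rw [abs_lt] at ha₀ ha ha₁
  rcases h₀ with ⟨e1, e2, e3⟩ | ⟨e1, e2, e3⟩ | ⟨e1, e2, e3⟩ | ⟨e1, e2, e3⟩ |
      ⟨e1, e2, e3⟩ | ⟨e1, e2, e3⟩ | ⟨e1, e2, e3⟩ | ⟨e1, e2, e3⟩ <;>
  rcases h₁ with ⟨e4, e5, e6⟩ | ⟨e4, e5, e6⟩ | ⟨e4, e5, e6⟩ | ⟨e4, e5, e6⟩ |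
      ⟨e4, e5, e6⟩ | ⟨e4, e5, e6⟩ | ⟨e4, e5, e6⟩ | ⟨e4, e5, e6⟩ <;>
  first
  | exact absurd (e2.symm.trans e4) (by decide)
  | (rw [e1] at ha₀
     rw [e5] at ha₁
     rw [e1, e2, e5]
     rw [e2] at ha
     simp only [sectorFlow_width_zero, sectorFlow_width_one, sectorFlow_width_two,
      sectorFlow_width_three, sectorFlow_width_four, abs_neg, abs_of_nonneg hx, abs_of_nonneg hy,
      abs_of_nonneg h0, abs_of_nonneg h1, abs_of_nonneg h2] at ha₀ ha ha₁ ⊢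
     obtain ⟨l0, r0⟩ := ha₀
     obtain ⟨l, r⟩ := ha
     obtain ⟨l1, r1⟩ := ha₁
     first
     | refine Or.inl ⟨by decide, by decide, fun hlt => ?_⟩
       -- Widths such as `φ * x - y` have no fixed sign, so each bound by an absolute value is split
       -- into two cases.
       rw [abs_lt, neg_lt, lt_abs, lt_abs] at hlt
       rcases hlt with ⟨g1 | g1, g2 | g2⟩ <;> linarith
     | refine Or.inr (Or.inl ⟨by decide, by decide, fun hlt => ?_⟩)
       rw [abs_lt, neg_lt, lt_abs, lt_abs] at hlt
       rcases hlt with ⟨g1 | g1, g2 | g2⟩ <;> linarith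
     | refine Or.inr (Or.inr (Or.inl ⟨by decide, by decide, ?_, by linarith⟩))
       first
       | exact abs_lt.2 ⟨by linarith, by linarith⟩
       | exact lt_abs.2 (Or.inl (abs_lt.2 ⟨by linarith, by linarith⟩))
       | exact lt_abs.2 (Or.inr (abs_lt.2 ⟨by linarith, by linarith⟩))
     | refine Or.inr (Or.inr (Or.inr ⟨by decide, by decide, ?_, by linarith⟩))
       first
       | exact abs_lt.2 ⟨by linarith, by linarith⟩
       | exact lt_abs.2 (Or.inl (abs_lt.2 ⟨by linarith, by linarith⟩))
       | exact lt_abs.2 (Or.inr (abs_lt.2 ⟨by linarith, by linarith⟩)))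

/-- Two different sides that may follow the same side have disjoint open shadows, so the flow is
deterministic. -/
theorem SectorStep.unique (hx : 0 ≤ x) (hy : 0 ≤ y) {c c₁ c₂ : ZMod 5 × ℝ}
    (ha₁ : (sectorFlow x y).Admits c₁) (ha₂ : (sectorFlow x y).Admits c₂)
    (h₁ : SectorStep x y c c₁) (h₂ : SectorStep x y c c₂) : c₁ = c₂ := by
  have hφ := goldenRatio_gt
  have h0 : 0 ≤ φ * x + y := by positivity
  have h1 : 0 ≤ φ * x + φ * y := by positivity
  have h2 : 0 ≤ x + φ * y := by positivity
  unfold Admits at *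
  rw [abs_lt] at ha₁ ha₂
  rcases h₁ with ⟨e1, e2, e3⟩ | ⟨e1, e2, e3⟩ | ⟨e1, e2, e3⟩ | ⟨e1, e2, e3⟩ |
      ⟨e1, e2, e3⟩ | ⟨e1, e2, e3⟩ | ⟨e1, e2, e3⟩ | ⟨e1, e2, e3⟩ <;>
  rcases h₂ with ⟨e4, e5, e6⟩ | ⟨e4, e5, e6⟩ | ⟨e4, e5, e6⟩ | ⟨e4, e5, e6⟩ |
      ⟨e4, e5, e6⟩ | ⟨e4, e5, e6⟩ | ⟨e4, e5, e6⟩ | ⟨e4, e5, e6⟩ <;>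
  first
  | exact absurd (e1.symm.trans e4) (by decide)
  | exact Prod.ext (e2.trans e5.symm) (e3.trans e6.symm)
  | (exfalso
     rw [e2] at ha₁
     rw [e5] at ha₂
     simp only [sectorFlow_width_zero, sectorFlow_width_one, sectorFlow_width_two,
      sectorFlow_width_three, sectorFlow_width_four, abs_neg, abs_of_nonneg hx, abs_of_nonneg hy,
      abs_of_nonneg h0, abs_of_nonneg h1, abs_of_nonneg h2] at ha₁ ha₂
     obtain ⟨l1, r1⟩ := ha₁
     obtain ⟨l2, r2⟩ := ha₂
     linarith)

/-- The width of a state in the reflected flow, counted only at the turning points. -/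
def turnWidth (x y : ℝ) (c : ZMod 5 × ℝ) : ℝ :=
  if |c.2| < |(sectorFlow x (-y)).width c.1| then |(sectorFlow x (-y)).width c.1| else 0

theorem turnWidth_of_admits {c : ZMod 5 × ℝ} (h : (sectorFlow x (-y)).Admits c) :
    turnWidth x y c = |(sectorFlow x (-y)).width c.1| := if_pos h

theorem turnWidth_of_not_admits {c : ZMod 5 × ℝ} (h : ¬ (sectorFlow x (-y)).Admits c) :
    turnWidth x y c = 0 := if_neg h

/-- Away from turning points the step sign does not change. At a maximum it drops by 2 and the
reflected width is positive; at a minimum it rises by 2 and the width is negative. -/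
theorem stepSign_sub_mul_width (hx : 0 ≤ x) (hy : 0 ≤ y) {c₀ c c₁ : ZMod 5 × ℝ}
    (ha₀ : (sectorFlow x y).Admits c₀) (ha : (sectorFlow x y).Admits c)
    (ha₁ : (sectorFlow x y).Admits c₁) (h₀ : SectorStep x y c₀ c) (h₁ : SectorStep x y c c₁) :
    (stepSign c₀ c - stepSign c c₁) * (sectorFlow x (-y)).width c.1 = 2 * turnWidth x y c := by
  rcases turn_cases hx hy ha₀ ha ha₁ h₀ h₁ with ⟨h, h', ht⟩ | ⟨h, h', ht⟩ | ⟨h, h', ht, hb⟩ |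
    ⟨h, h', ht, hb⟩
  · rw [stepSign_of_ascends h, stepSign_of_ascends h', turnWidth_of_not_admits ht]; ring
  · rw [stepSign_of_not_ascends h, stepSign_of_not_ascends h', turnWidth_of_not_admits ht]; ring
  · rw [stepSign_of_ascends h, stepSign_of_not_ascends h', turnWidth_of_admits ht, abs_of_pos hb]; ring
  · rw [stepSign_of_not_ascends h, stepSign_of_ascends h', turnWidth_of_admits ht, abs_of_neg hb]; ring

/-- The weight of a cycle is proportional to its weight counted at the turning points. -/
theorem Cycle.weight_eq_sum_turnWidth (hx : 0 ≤ x) (hy : 0 ≤ y) (o : Cycle (sectorFlow x y)) :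
    (x ^ 2 - φ * x * y + y ^ 2) * o.weight = (x ^ 2 + φ * x * y + y ^ 2) *
      ∑ n ∈ Finset.range o.period, turnWidth x y (o.state n) := by
  -- Summation by parts: subtracting consecutive values of step sign times reflected width leaves
  -- the contribution of the turning points.
  have key : ∀ n, (x ^ 2 - φ * x * y + y ^ 2) *
      (|(sectorFlow x y).width (o.state n).1| + |(sectorFlow x y).width (o.state (n + 1)).1|) =
      (x ^ 2 + φ * x * y + y ^ 2) * (2 * turnWidth x y (o.state (n + 1)) +
        (stepSign (o.state (n + 1)) (o.state (n + 1 + 1)) *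
            (sectorFlow x (-y)).width (o.state (n + 1)).1 -
          stepSign (o.state n) (o.state (n + 1)) * (sectorFlow x (-y)).width (o.state n).1)) +
        2 * (x ^ 2 - y ^ 2) * ((o.state (n + 1)).2 - (o.state n).2) := by
    intro n
    have h1 := (o.sectorStep hx hy n).width_add_width hx hy
    have h2 := stepSign_sub_mul_width hx hy (o.admits n) (o.admits (n + 1)) (o.admits (n + 1 + 1))
      (o.sectorStep hx hy n) (o.sectorStep hx hy (n + 1))
    linear_combination h1 + (x ^ 2 + φ * x * y + y ^ 2) * h2
  have h0 : o.state o.period = o.state 0 := by simpa using o.closes_up 0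
  have h1 : o.state (o.period + 1) = o.state (0 + 1) := by
    rw [add_comm o.period, o.closes_up 1]
  have hs := Finset.sum_congr (rfl : Finset.range o.period = _) (fun n _ => key n)
  rw [← Finset.mul_sum, Finset.sum_add_distrib, Finset.sum_add_distrib, ← Finset.mul_sum,
    ← Finset.mul_sum, Finset.sum_add_distrib, ← Finset.mul_sum,
    o.sum_range_succ_sub (fun n => (o.state n).2) (by rw [h0]),
    o.sum_range_succ_sub (fun n => stepSign (o.state n) (o.state (n + 1)) *
      (sectorFlow x (-y)).width (o.state n).1) (by rw [h0, h1]),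
    o.sum_range_succ_period (turnWidth x y),
    o.sum_range_succ_period (fun c => |(sectorFlow x y).width c.1|)] at hs
  change _ * (o.weight + o.weight) = _ at hs
  linarith

/-! ### Passages between turning points -/

theorem intermediate_eq :
    intermediate 1 4 = [] ∧ intermediate 1 3 = [4] ∧ intermediate 1 2 = [4, 3] ∧
    intermediate 1 0 = [4, 3, 2] ∧ intermediate 4 3 = [] ∧ intermediate 4 2 = [3] ∧
    intermediate 4 0 = [3, 2] ∧ intermediate 3 2 = [] ∧ intermediate 3 0 = [2] ∧
    intermediate 2 0 = [] ∧
    intermediate 4 1 = [] ∧ intermediate 3 1 = [4] ∧ intermediate 2 1 = [3, 4] ∧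
    intermediate 0 1 = [2, 3, 4] ∧ intermediate 3 4 = [] ∧ intermediate 2 4 = [3] ∧
    intermediate 0 4 = [2, 3] ∧ intermediate 2 3 = [] ∧ intermediate 0 3 = [2] ∧
    intermediate 0 2 = [] := by
  decide

/-- The state with the side `p` on the way from the reflection of `c` to the next turning point. -/
def passingState (x y : ℝ) (c : ZMod 5 × ℝ) (p : ZMod 5) : ZMod 5 × ℝ :=
  if (sectorFlow x (-y)).width c.1 < 0 then
    (p, -c.2 + ((sectorFlow x (-y)).position p - (sectorFlow x (-y)).position c.1))
  else (p, -c.2 - ((sectorFlow x (-y)).position p - (sectorFlow x (-y)).position c.1))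

/-- The states passed between the turning points that are the reflections of `c` and `c'`. -/
def passage (x y : ℝ) (c c' : ZMod 5 × ℝ) : List (ZMod 5 × ℝ) :=
  (intermediate c.1 c'.1).map (passingState x y c)

/-- The reflection of a state. -/
def reflect (c : ZMod 5 × ℝ) : ZMod 5 × ℝ := (c.1, -c.2)

theorem reflect_injective : Function.Injective reflect := by
  rintro ⟨i, u⟩ ⟨j, v⟩ h
  simpa [reflect] using h

theorem admits_reflect {D : LinearFlow} {c : ZMod 5 × ℝ} : D.Admits (reflect c) ↔ D.Admits c := by
  simp [Admits, reflect]

theorem map_fst_passage (c c' : ZMod 5 × ℝ) :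
    (passage x y c c').map Prod.fst = intermediate c.1 c'.1 := by
  have : Prod.fst ∘ passingState x y c = id := by
    funext p
    simp only [Function.comp_apply, passingState]
    split_ifs <;> rfl
  rw [passage, List.map_map, this, List.map_id]

theorem admits_of_admits_reflected (hx : 0 ≤ x) (hy : 0 ≤ y) {c : ZMod 5 × ℝ}
    (h : (sectorFlow x (-y)).Admits c) : (sectorFlow x y).Admits c := by
  have hφ := goldenRatio_gt
  have hφx : 0 ≤ φ * x := by positivity
  have hφy : 0 ≤ φ * y := by positivity
  obtain ⟨i, u⟩ := c
  unfold Admits at *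
  refine h.trans_le ?_
  rcases side_cases i with rfl | rfl | rfl | rfl | rfl <;>
  simp only [sectorFlow_width_zero, sectorFlow_width_one, sectorFlow_width_two,
    sectorFlow_width_three, sectorFlow_width_four, abs_neg] <;>
  exact abs_le_abs (by linarith) (by linarith)

-- The sign of the reflected width at `c` decides whether one ascends or descends, and the offset
-- moves with the reflected positions. The inserted states are not admitted by the reflected flow,
-- so they create no new turning points; this later gives both the weight and the fact that the
-- enhanced cycle is traversed once.
set_option maxHeartbeats 1000000 in
theorem isChain_passage (hx : 0 ≤ x) (hy : 0 ≤ y) {c c' : ZMod 5 × ℝ}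
    (hc : (sectorFlow x (-y)).Admits c) (hc' : (sectorFlow x (-y)).Admits c')
    (h : (sectorFlow x (-y)).Next c c') :
    (reflect c :: (passage x y c c' ++ [reflect c'])).IsChain (sectorFlow x y).Next ∧
      ∀ s ∈ passage x y c c', (sectorFlow x y).Admits s ∧ ¬ (sectorFlow x (-y)).Admits s := by
  have hφ := goldenRatio_gt
  have hφ' := goldenRatio_lt
  have hφx : 0 ≤ (φ - 8 / 5) * x := mul_nonneg (by linarith) hx
  have hφy : 0 ≤ (φ - 8 / 5) * y := mul_nonneg (by linarith) hy
  have h0 : 0 ≤ φ * x + y := by positivity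
  have h1 : 0 ≤ φ * x + φ * y := by positivity
  have h2 : 0 ≤ x + φ * y := by positivity
  obtain ⟨i, u⟩ := c
  obtain ⟨j, u'⟩ := c'
  unfold Admits at *
  unfold passage passingState reflect
  rcases h with ⟨hw, hw', e⟩ | ⟨hw, hw', e⟩
  · rw [abs_lt, abs_of_neg hw] at hc
    rw [abs_lt, abs_of_pos hw'] at hc'
    simp only [if_pos hw]
    rcases side_cases i with rfl | rfl | rfl | rfl | rfl <;>
    rcases side_cases j with rfl | rfl | rfl | rfl | rfl <;>
    simp only [sectorFlow_width_zero, sectorFlow_width_one, sectorFlow_width_two,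
      sectorFlow_width_three, sectorFlow_width_four, sectorFlow_position_zero,
      sectorFlow_position_one, sectorFlow_position_two, sectorFlow_position_three,
      sectorFlow_position_four] at hc hc' hw hw' e <;>
    first
    | (exfalso; linarith [hc.1, hc.2, hc'.1, hc'.2])
    | (obtain ⟨l, r⟩ := hc
       obtain ⟨l', r'⟩ := hc'
       simp only [intermediate_eq, List.map_cons, List.map_nil, List.cons_append, List.nil_append,
        List.isChain_cons_cons, List.isChain_singleton, and_true, List.mem_cons,
        List.not_mem_nil, or_false, forall_eq_or_imp, forall_eq, Next, sectorFlow_width_zero,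
        sectorFlow_width_one, sectorFlow_width_two, sectorFlow_width_three, sectorFlow_width_four,
        sectorFlow_position_zero, sectorFlow_position_one, sectorFlow_position_two,
        sectorFlow_position_three, sectorFlow_position_four, abs_neg, abs_of_nonneg h0,
        abs_of_nonneg h1, abs_of_nonneg h2]
       repeat' apply And.intro
       all_goals first
       | exact Or.inl ⟨by linarith, by linarith, by linarith⟩
       | exact Or.inr ⟨by linarith, by linarith, by linarith⟩
       | exact fun _ h => h.elim
       | exact abs_lt.2 ⟨by linarith, by linarith⟩
       | (intro hlt
          rw [abs_lt, neg_lt, lt_abs, lt_abs] at hlt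
          rcases hlt with ⟨g1 | g1, g2 | g2⟩ <;> linarith))
  · rw [abs_lt, abs_of_pos hw] at hc
    rw [abs_lt, abs_of_neg hw'] at hc'
    simp only [if_neg (not_lt.2 hw.le)]
    rcases side_cases i with rfl | rfl | rfl | rfl | rfl <;>
    rcases side_cases j with rfl | rfl | rfl | rfl | rfl <;>
    simp only [sectorFlow_width_zero, sectorFlow_width_one, sectorFlow_width_two,
      sectorFlow_width_three, sectorFlow_width_four, sectorFlow_position_zero,
      sectorFlow_position_one, sectorFlow_position_two, sectorFlow_position_three,
      sectorFlow_position_four] at hc hc' hw hw' e <;>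
    first
    | (exfalso; linarith [hc.1, hc.2, hc'.1, hc'.2])
    | (obtain ⟨l, r⟩ := hc
       obtain ⟨l', r'⟩ := hc'
       simp only [intermediate_eq, List.map_cons, List.map_nil, List.cons_append, List.nil_append,
        List.isChain_cons_cons, List.isChain_singleton, and_true, List.mem_cons,
        List.not_mem_nil, or_false, forall_eq_or_imp, forall_eq, Next, sectorFlow_width_zero,
        sectorFlow_width_one, sectorFlow_width_two, sectorFlow_width_three, sectorFlow_width_four,
        sectorFlow_position_zero, sectorFlow_position_one, sectorFlow_position_two,
        sectorFlow_position_three, sectorFlow_position_four, abs_neg, abs_of_nonneg h0,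
        abs_of_nonneg h1, abs_of_nonneg h2]
       repeat' apply And.intro
       all_goals first
       | exact Or.inl ⟨by linarith, by linarith, by linarith⟩
       | exact Or.inr ⟨by linarith, by linarith, by linarith⟩
       | exact fun _ h => h.elim
       | exact abs_lt.2 ⟨by linarith, by linarith⟩
       | (intro hlt
          rw [abs_lt, neg_lt, lt_abs, lt_abs] at hlt
          rcases hlt with ⟨g1 | g1, g2 | g2⟩ <;> linarith))

end LinearFlow

/-! ### Cyclic lists and periodic sequences -/

/-- A list that is a chain when read cyclically gives a periodic sequence. -/
theorem exists_periodic_of_isChain {α : Type*} {R : α → α → Prop} (a : α) (t : List α)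
    (h : (a :: (t ++ [a])).IsChain R) :
    ∃ f : ℕ → α, (∀ n, R (f n) (f (n + 1))) ∧ (∀ n, f (n + (t.length + 1)) = f n) ∧
      (∀ n, f n ∈ a :: t) ∧ (List.range (t.length + 1)).map f = a :: t ∧ f 0 = a ∧
      ∀ m, 0 < m → m < t.length + 1 → f m ∈ t := by
  have hlt : ∀ n, n % (t.length + 1) < (a :: t).length := fun n => Nat.mod_lt _ (by simp)
  refine ⟨fun n => (a :: t)[n % (t.length + 1)]'(hlt n), fun n => ?_, fun n => ?_, fun n => ?_,
    ?_, ?_, fun m h0 h1 => ?_⟩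
  · have hn := hlt n
    rw [List.length_cons] at hn
    have h1 := List.isChain_iff_getElem.1 h (n % (t.length + 1)) (by simpa using hn)
    have e1 : (a :: (t ++ [a]))[n % (t.length + 1)]'(by simp; omega) =
        (a :: t)[n % (t.length + 1)]'(hlt n) := by
      rw [← List.getElem_append_left (as := a :: t) (bs := [a])]
      rfl
    rw [e1] at h1
    convert h1 using 1
    by_cases hl : n % (t.length + 1) + 1 = t.length + 1
    · have e2 : (n + 1) % (t.length + 1) = 0 := by
        rw [Nat.add_mod]
        -- For empty `t` the modulus is 1, and 1 does not reduce to itself.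
        rcases Nat.eq_zero_or_pos t.length with h | h
        · simp [h, Nat.mod_one]
        · rw [Nat.mod_eq_of_lt (a := 1) (by omega), hl, Nat.mod_self]
      simp only [e2, hl]
      simp
    · have e2 : (n + 1) % (t.length + 1) = n % (t.length + 1) + 1 := by
        rw [Nat.add_mod, Nat.mod_eq_of_lt (a := 1) (by omega), Nat.mod_eq_of_lt (by omega)]
      simp only [e2]
      simp only [List.getElem_cons_succ]
      rw [List.getElem_append_left]
  · simp only [Nat.add_mod_right]
  · exact List.getElem_mem _
  · refine List.ext_getElem (by simp) fun n h1 h2 => ?_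
    simp only [List.getElem_map, List.getElem_range]
    congr 1
    exact Nat.mod_eq_of_lt (by simpa using h1)
  · simp
  · obtain ⟨m, rfl⟩ : ∃ k, m = k + 1 := ⟨m - 1, by omega⟩
    simp only [Nat.mod_eq_of_lt h1, List.getElem_cons_succ]
    exact List.getElem_mem _

theorem isChain_flatMap_range {α : Type*} {R : α → α → Prop} (s : ℕ → α) (t : ℕ → List α)
    (h : ∀ n, (s n :: (t n ++ [s (n + 1)])).IsChain R) (N : ℕ) :
    ((List.range N).flatMap (fun n => s n :: t n) ++ [s N]).IsChain R := by
  induction N with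
  | zero => simp
  | succ N ih =>
    rw [List.range_succ, List.flatMap_append, List.flatMap_singleton, List.append_assoc,
      List.cons_append]
    rw [List.isChain_append] at ih ⊢
    refine ⟨ih.1, h N, fun a ha b hb => ih.2.2 a ha b ?_⟩
    simpa using hb

theorem sum_map_range (g : ℕ → ℝ) (N : ℕ) :
    ((List.range N).map g).sum = ∑ n ∈ Finset.range N, g n := by
  induction N with
  | zero => simp
  | succ N ih => simp [List.range_succ, Finset.sum_range_succ, ih]

theorem sum_map_flatMap_range {α : Type*} (s : ℕ → α) (t : ℕ → List α) (g : α → ℝ)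
    (h : ∀ n, ∀ a ∈ t n, g a = 0) (N : ℕ) :
    (((List.range N).flatMap (fun n => s n :: t n)).map g).sum =
      ∑ n ∈ Finset.range N, g (s n) := by
  induction N with
  | zero => simp
  | succ N ih =>
    have h0 : ((t N).map g).sum = 0 := by
      refine List.sum_eq_zero fun b hb => ?_
      obtain ⟨a, ha, rfl⟩ := List.mem_map.1 hb
      exact h N a ha
    rw [List.range_succ, List.flatMap_append, List.flatMap_singleton, List.map_append,
      List.sum_append, ih, List.map_cons, List.sum_cons, h0, add_zero, Finset.sum_range_succ]

theorem enhance_map_range {N : ℕ} (s : ℕ → ZMod 5) (hs : ∀ n, s (n + N) = s n) :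
    enhance ((List.range N).map s) =
      (List.range N).flatMap (fun n => s n :: intermediate (s n) (s (n + 1))) := by
  have h1 : ((List.range N).map s).zip (((List.range N).map s).rotate 1) =
      (List.range N).map (fun n => (s n, s (n + 1))) := by
    refine List.ext_getElem (by simp) fun n h1 h2 => ?_
    have hn : n < N := by simpa using h2
    simp only [List.getElem_zip, List.getElem_map, List.getElem_range, List.getElem_rotate,
      List.length_map, List.length_range, Prod.mk.injEq, true_and]
    by_cases hl : n + 1 = N
    · rw [hl, Nat.mod_self]
      simpa using (hs 0).symm
    · rw [Nat.mod_eq_of_lt (by omega)]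
  rw [enhance, h1, List.flatMap_map]

namespace LinearFlow

variable {x y : ℝ}

/-- Inserting the passages between its states turns a cycle of the reflected flow into a cycle of
the flow in the principal sector. -/
theorem exists_enhanced_cycle (hx : 0 ≤ x) (hy : 0 ≤ y) (o : Cycle (sectorFlow x (-y))) :
    ∃ o' : Cycle (sectorFlow x y), o'.word = enhance o.word ∧
      (x ^ 2 - φ * x * y + y ^ 2) * o'.weight =
        (x ^ 2 + φ * x * y + y ^ 2) * o.weight := by
  set s : ℕ → ZMod 5 × ℝ := fun n => reflect (o.state n) with hs
  set t : ℕ → List (ZMod 5 × ℝ) := fun n => passage x y (o.state n) (o.state (n + 1)) with ht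
  have hpass := fun n => isChain_passage hx hy (o.admits n) (o.admits (n + 1)) (o.next n)
  have hper : s o.period = s 0 := by
    have := o.closes_up 0
    rw [zero_add] at this
    simp only [hs, this]
  -- The first state is split off, so that the concatenated list has the form `a :: t` needed to
  -- close it into a periodic sequence.
  obtain ⟨K, hK⟩ : ∃ K, o.period = K + 1 := ⟨o.period - 1, by have := o.period_pos; omega⟩
  have hchain := isChain_flatMap_range s t (fun n => (hpass n).1) o.period
  set T := t 0 ++ (List.range K).flatMap (fun n => s (n + 1) :: t (n + 1)) with hT
  have hL : (List.range o.period).flatMap (fun n => s n :: t n) = s 0 :: T := by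
    rw [hK, List.range_succ_eq_map, List.flatMap_cons, List.flatMap_map, hT, List.cons_append]
  have hmem : ∀ c ∈ s 0 :: T, ∃ n, c = s n ∨ c ∈ t n := by
    intro c hc
    rw [← hL, List.mem_flatMap] at hc
    obtain ⟨n, -, hn⟩ := hc
    exact ⟨n, List.mem_cons.1 hn⟩
  have hadm : ∀ n, (sectorFlow x (-y)).Admits (s n) := fun n =>
    admits_reflect.2 (o.admits n)
  rw [hL, hper, List.cons_append] at hchain
  obtain ⟨f, hf, hfper, hfmem, hfmap, hf0, hftail⟩ := exists_periodic_of_isChain _ _ hchain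
  let o' : Cycle (sectorFlow x y) :=
    { period := T.length + 1
      period_pos := Nat.succ_pos _
      state := f
      admits := fun n => by
        obtain ⟨m, hm | hm⟩ := hmem _ (hfmem n)
        · rw [hm]
          exact admits_of_admits_reflected hx hy (hadm m)
        · exact ((hpass m).2 _ hm).1
      next := hf
      closes_up := hfper
      traversed_once := fun m h0 h1 heq => by
        have h2 := hftail m h0 h1
        rw [heq, hf0, hT, List.mem_append, List.mem_flatMap] at h2
        rcases h2 with h2 | ⟨n, hn, h2⟩
        · exact ((hpass 0).2 _ h2).2 (hadm 0)
        · rcases List.mem_cons.1 h2 with h2 | h2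
          · refine o.traversed_once (n + 1) (Nat.succ_pos _) ?_ (reflect_injective h2.symm)
            rw [hK]
            exact Nat.succ_lt_succ (List.mem_range.1 hn)
          · exact ((hpass (n + 1)).2 _ h2).2 (hadm 0) }
  refine ⟨o', ?_, ?_⟩
  · have h1 : o'.word = (s 0 :: T).map Prod.fst := by
      rw [← hfmap, List.map_map]
      rfl
    have h2 : ∀ n, (o.state (n + o.period)).1 = (o.state n).1 := fun n => by rw [o.closes_up]
    rw [h1, ← hL, Cycle.word, enhance_map_range _ h2, List.map_flatMap]
    simp only [List.map_cons, ht, map_fst_passage]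
    rfl
  · rw [o'.weight_eq_sum_turnWidth hx hy]
    congr 1
    calc ∑ n ∈ Finset.range o'.period, turnWidth x y (o'.state n)
        = ((s 0 :: T).map (turnWidth x y)).sum := by
          rw [← hfmap, List.map_map, sum_map_range]
          rfl
      _ = ∑ n ∈ Finset.range o.period, turnWidth x y (s n) := by
          rw [← hL]
          exact sum_map_flatMap_range s t _
            (fun n c hc => turnWidth_of_not_admits ((hpass n).2 c hc).2) _
      _ = o.weight := Finset.sum_congr rfl fun n _ => turnWidth_of_admits (hadm n)

end LinearFlow

/-! ### Extracting the turning points of a cycle -/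

theorem sum_ite_range_eq_sum_nth (p : ℕ → Prop) [DecidablePred p] (g : ℕ → ℝ) (N : ℕ) :
    ∑ n ∈ Finset.range N, (if p n then g n else 0) =
      ∑ k ∈ Finset.range (Nat.count p N), g (Nat.nth p k) := by
  induction N with
  | zero => simp
  | succ N ih =>
    rw [Finset.sum_range_succ, ih, Nat.count_succ]
    split_ifs with h
    · rw [Finset.sum_range_succ, Nat.nth_count h]
    · simp

/-- The increasing enumeration of an unbounded periodic set of natural numbers. -/
theorem nth_add_count_of_periodic {p : ℕ → Prop} [DecidablePred p] (hp : {n | p n}.Infinite)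
    {N : ℕ} (hN : ∀ n, p (n + N) ↔ p n) (k : ℕ) :
    Nat.nth p (k + Nat.count p N) = Nat.nth p k + N := by
  have h1 : p (Nat.nth p k + N) := (hN _).2 (Nat.nth_mem_of_infinite hp k)
  have h2 : Nat.count p (Nat.nth p k + N) = k + Nat.count p N := by
    rw [add_comm (Nat.nth p k), Nat.count_add]
    have : (fun n => p (N + n)) = p := by
      funext n
      rw [add_comm, hN]
    simp only [this]
    rw [Nat.count_nth_of_infinite hp, add_comm]
  rw [← h2, Nat.nth_count h1]

namespace LinearFlow

theorem Cycle.state_add_mul_period {D : LinearFlow} (o : Cycle D) (n k : ℕ) :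
    o.state (n + k * o.period) = o.state n := by
  induction k with
  | zero => simp
  | succ k ih => rw [Nat.succ_mul, ← add_assoc, o.closes_up, ih]

variable {x y : ℝ}

theorem Cycle.exists_pred (hx : 0 ≤ x) (hy : 0 ≤ y) (o : Cycle (sectorFlow x y)) (n : ℕ) :
    ∃ c, (sectorFlow x y).Admits c ∧ SectorStep x y c (o.state n) := by
  refine ⟨o.state (n + o.period - 1), o.admits _, ?_⟩
  have h := o.sectorStep hx hy (n + o.period - 1)
  have := o.period_pos
  rwa [Nat.sub_add_cancel (by omega), o.closes_up] at h

/-- From a turning point a walk proceeds monotonically until it reaches the next one. -/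
theorem Cycle.monotone_between_turns (hx : 0 ≤ x) (hy : 0 ≤ y) (o : Cycle (sectorFlow x y)) {n : ℕ}
    (hn : (sectorFlow x (-y)).Admits (o.state n)) (i : ℕ)
    (hi : ∀ m, n < m → m ≤ n + i → ¬ (sectorFlow x (-y)).Admits (o.state m)) :
    ((sectorFlow x (-y)).width (o.state n).1 < 0 ∧
      Ascends (o.state (n + i)) (o.state (n + i + 1)) ∧
      (o.state (n + i + 1)).2 - (o.state n).2 =
        (sectorFlow x (-y)).position (o.state (n + i + 1)).1 -
          (sectorFlow x (-y)).position (o.state n).1) ∨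
    (0 < (sectorFlow x (-y)).width (o.state n).1 ∧
      ¬ Ascends (o.state (n + i)) (o.state (n + i + 1)) ∧
      (o.state (n + i + 1)).2 - (o.state n).2 =
        (sectorFlow x (-y)).position (o.state n).1 -
          (sectorFlow x (-y)).position (o.state (n + i + 1)).1) := by
  induction i with
  | zero =>
    obtain ⟨c, hc, hs⟩ := o.exists_pred hx hy n
    have hs' := o.sectorStep hx hy n
    rw [add_zero]
    rcases turn_cases hx hy hc (o.admits n) (o.admits (n + 1)) hs hs' with
      ⟨-, -, h⟩ | ⟨-, -, h⟩ | ⟨-, h, -, hb⟩ | ⟨-, h, -, hb⟩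
    · exact absurd hn h
    · exact absurd hn h
    · rcases hs'.offset_sub with ⟨h', -⟩ | ⟨-, e⟩
      · exact absurd h' h
      · exact Or.inr ⟨hb, h, e⟩
    · rcases hs'.offset_sub with ⟨-, e⟩ | ⟨h', -⟩
      · exact Or.inl ⟨hb, h, e⟩
      · exact absurd h h'
  | succ i ih =>
    have ih := ih fun m h1 h2 => hi m h1 (by omega)
    have hnot := hi (n + (i + 1)) (by omega) le_rfl
    rw [← add_assoc] at hnot ⊢
    have hs' := o.sectorStep hx hy (n + i + 1)
    rcases turn_cases hx hy (o.admits (n + i)) (o.admits (n + i + 1)) (o.admits (n + i + 1 + 1))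
      (o.sectorStep hx hy (n + i)) hs' with
      ⟨h0, h1, h⟩ | ⟨h0, h1, h⟩ | ⟨-, -, h, -⟩ | ⟨-, -, h, -⟩
    · rcases ih with ⟨hb, -, e⟩ | ⟨-, h', -⟩
      · rcases hs'.offset_sub with ⟨-, e'⟩ | ⟨h', -⟩
        · exact Or.inl ⟨hb, h1, by linarith⟩
        · exact absurd h1 h'
      · exact absurd h0 h'
    · rcases ih with ⟨-, h', -⟩ | ⟨hb, -, e⟩
      · exact absurd h' h0
      · rcases hs'.offset_sub with ⟨h', -⟩ | ⟨-, e'⟩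
        · exact absurd h' h1
        · exact Or.inr ⟨hb, h1, by linarith⟩
    · exact absurd h hnot
    · exact absurd h hnot

/-- Consecutive turning points of a walk follow each other in the reflected flow. -/
theorem Cycle.next_turn (hx : 0 ≤ x) (hy : 0 ≤ y) (o : Cycle (sectorFlow x y)) {n m : ℕ}
    (hnm : n < m) (hn : (sectorFlow x (-y)).Admits (o.state n))
    (hm : (sectorFlow x (-y)).Admits (o.state m))
    (hi : ∀ i, n < i → i < m → ¬ (sectorFlow x (-y)).Admits (o.state i)) :
    (sectorFlow x (-y)).Next (reflect (o.state n)) (reflect (o.state m)) := by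
  obtain ⟨i, rfl⟩ : ∃ i, m = n + i + 1 := ⟨m - n - 1, by omega⟩
  have h1 := o.monotone_between_turns hx hy hn i fun m h1 h2 => hi m h1 (by omega)
  rcases turn_cases hx hy (o.admits (n + i)) (o.admits (n + i + 1)) (o.admits (n + i + 1 + 1))
      (o.sectorStep hx hy (n + i)) (o.sectorStep hx hy (n + i + 1)) with
      ⟨-, -, h⟩ | ⟨-, -, h⟩ | ⟨h0, -, -, hb⟩ | ⟨h0, -, -, hb⟩
  · exact absurd hm h
  · exact absurd hm h
  · rcases h1 with ⟨hb', -, e⟩ | ⟨-, h', -⟩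
    · refine Or.inl ⟨hb', hb, ?_⟩
      simp only [reflect]
      linarith
    · exact absurd h0 h'
  · rcases h1 with ⟨-, h', -⟩ | ⟨hb', -, e⟩
    · exact absurd h' h0
    · refine Or.inr ⟨hb', hb, ?_⟩
      simp only [reflect]
      linarith

theorem Cycle.state_add_eq (hx : 0 ≤ x) (hy : 0 ≤ y) (o : Cycle (sectorFlow x y)) {n m : ℕ}
    (h : o.state n = o.state m) (i : ℕ) : o.state (n + i) = o.state (m + i) := by
  induction i with
  | zero => exact h
  | succ i ih =>
    have h1 := o.sectorStep hx hy (n + i)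
    have h2 := o.sectorStep hx hy (m + i)
    rw [ih] at h1
    exact SectorStep.unique hx hy (o.admits _) (o.admits _) h1 h2

/-- The definition of a cycle excludes early returns only to the state number 0; determinism extends
this to every starting index. -/
theorem Cycle.eq_of_state_eq (hx : 0 ≤ x) (hy : 0 ≤ y) (o : Cycle (sectorFlow x y)) {n d : ℕ}
    (hd : d < o.period) (h : o.state (n + d) = o.state n) : d = 0 := by
  by_contra h0
  have hP := o.period_pos
  have hle : n ≤ n * o.period := Nat.le_mul_of_pos_right n hP
  -- After `n * o.period - n` further steps the index `n` becomes a multiple of the period, where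
  -- the state is the initial one.
  have h1 := o.state_add_eq hx hy h (n * o.period - n)
  have e1 : n + d + (n * o.period - n) = d + n * o.period := by omega
  have e2 : n + (n * o.period - n) = 0 + n * o.period := by omega
  rw [e1, e2, o.state_add_mul_period, o.state_add_mul_period] at h1
  exact o.traversed_once d (Nat.pos_of_ne_zero h0) hd h1

/-- The form is positive definite because `φ < 2`. -/
theorem reflected_quadratic_pos (hx : 0 ≤ x) (hy : 0 ≤ y) (hxy : 0 < x + y) :
    0 < x ^ 2 - φ * x * y + y ^ 2 := by
  have hφ := goldenRatio_lt
  have h1 : 0 ≤ (2 - φ) * (x * y) := mul_nonneg (by linarith) (by positivity)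
  have h2 : 0 < (2 - φ) * (x + y) ^ 2 := mul_pos (by linarith) (by positivity)
  nlinarith [sq_nonneg (x - y), mul_nonneg hx hy, mul_nonneg (show (0:ℝ) ≤ 2 + φ by
    linarith [goldenRatio_gt]) (sq_nonneg (x - y))]

/-- The turning points of a cycle in the principal sector form a cycle of the reflected flow. -/
theorem exists_turning_cycle (hx : 0 ≤ x) (hy : 0 ≤ y) (hxy : 0 < x + y)
    (o' : Cycle (sectorFlow x y)) :
    ∃ o : Cycle (sectorFlow x (-y)), (x ^ 2 - φ * x * y + y ^ 2) * o'.weight =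
        (x ^ 2 + φ * x * y + y ^ 2) * o.weight := by
  classical
  have hweight := o'.weight_eq_sum_turnWidth hx hy
  set p : ℕ → Prop := fun n => (sectorFlow x (-y)).Admits (o'.state n) with hp
  have hper : ∀ n, p (n + o'.period) ↔ p n := fun n => by simp only [hp, o'.closes_up]
  have hsum : ∑ n ∈ Finset.range o'.period, turnWidth x y (o'.state n) =
      ∑ k ∈ Finset.range (Nat.count p o'.period),
        |(sectorFlow x (-y)).width (o'.state (Nat.nth p k)).1| := by
    rw [← sum_ite_range_eq_sum_nth p (fun n => |(sectorFlow x (-y)).width (o'.state n).1|)]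
    refine Finset.sum_congr rfl fun n _ => ?_
    split_ifs with h
    · exact turnWidth_of_admits h
    · exact turnWidth_of_not_admits h
  rw [hsum] at hweight
  -- Without turning points the weight formula would give weight zero.
  have hK : 0 < Nat.count p o'.period := by
    rw [Nat.pos_iff_ne_zero]
    intro h0
    rw [h0, Finset.sum_range_zero, mul_zero] at hweight
    exact (mul_pos (reflected_quadratic_pos hx hy hxy) o'.weight_pos).ne' hweight
  have hinf : {n | p n}.Infinite := by
    obtain ⟨n, hn⟩ : ∃ n, p n := by
      by_contra h
      push Not at h
      have : Nat.count p o'.period = 0 := by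
        rw [Nat.count_eq_card_filter_range, Finset.card_eq_zero]
        exact Finset.filter_false_of_mem fun n _ => h n
      omega
    refine Set.infinite_of_forall_exists_gt fun a => ⟨n + (a + 1) * o'.period, ?_, ?_⟩
    · change (sectorFlow x (-y)).Admits _
      rw [o'.state_add_mul_period]
      exact hn
    · have := Nat.le_mul_of_pos_right (a + 1) o'.period_pos
      omega
  have hmono : StrictMono (Nat.nth p) := Nat.nth_strictMono hinf
  have hmem : ∀ k, p (Nat.nth p k) := Nat.nth_mem_of_infinite hinf
  have hshift := nth_add_count_of_periodic hinf hper
  refine ⟨⟨Nat.count p o'.period, hK, fun k => reflect (o'.state (Nat.nth p k)),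
    fun k => admits_reflect.2 (hmem k), fun k => ?_, fun k => ?_, fun m h0 h1 h => ?_⟩, hweight⟩
  · refine o'.next_turn hx hy (hmono (Nat.lt_succ_self k)) (hmem k) (hmem (k + 1))
      fun i h1 h2 hi => ?_
    have e : Nat.nth p (Nat.count p i) = i := Nat.nth_count hi
    rw [← e] at h1 h2
    have h1 := hmono.lt_iff_lt.1 h1
    have h2 := hmono.lt_iff_lt.1 h2
    omega
  · rw [hshift, o'.closes_up]
  -- The turning points number 0 and `m` are less than one period of `o'` apart, so equal states
  -- would force them to coincide.
  · have h2 := hmono h0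
    have h3 := hmono h1
    have h4 := hshift 0
    rw [zero_add] at h4
    have h5 := reflect_injective h
    obtain ⟨d, hd⟩ : ∃ d, Nat.nth p m = Nat.nth p 0 + d := ⟨_, (Nat.add_sub_cancel' h2.le).symm⟩
    rw [hd] at h5
    have := o'.eq_of_state_eq hx hy (by omega) h5
    omega

/-- The affine automorphism of the double pentagon that reflects the directions in the boundary of
the principal sector acts on the symbolic orbits by `enhance`. -/
theorem renormalizes_enhance (hx : 0 ≤ x) (hy : 0 ≤ y) (hxy : 0 < x + y) :
    Renormalizes (sectorFlow x (-y)) (sectorFlow x y) enhance := by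
  have hQ := reflected_quadratic_pos hx hy hxy
  have hQ' : 0 < x ^ 2 + φ * x * y + y ^ 2 := by
    have : 0 ≤ 2 * φ * x * y := by have := goldenRatio_gt; positivity
    linarith
  refine ⟨(x ^ 2 + φ * x * y + y ^ 2) / (x ^ 2 - φ * x * y + y ^ 2), by positivity,
    fun o => ?_, fun o' => ?_⟩
  · obtain ⟨o', hw, h⟩ := exists_enhanced_cycle hx hy o
    refine ⟨o', hw, ?_⟩
    rw [div_mul_eq_mul_div, eq_div_iff hQ.ne']
    linarith
  · obtain ⟨o, h⟩ := exists_turning_cycle hx hy hxy o'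
    refine ⟨o, ?_⟩
    rw [div_mul_eq_mul_div, eq_div_iff hQ.ne']
    linarith

end LinearFlow

/-! ### Trajectories as cycles of linear flows -/

/-- The linear flow in the direction of `v`. -/
def directionFlow (v : ℂ) : LinearFlow where
  width i := Real.tan (Real.pi / 5) * (sideMidpoint i * (starRingEnd ℂ) v).re
  position i := -(sideMidpoint i * (starRingEnd ℂ) v).im

/-- The state of the flow at a crossing. -/
def crossingState (v : ℂ) (c : Crossing) : ZMod 5 × ℝ :=
  (c.side, -((sideMidpoint c.side * (starRingEnd ℂ) v).re * c.param))

theorem tan_pi_div_five_pos : 0 < Real.tan (Real.pi / 5) :=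
  Real.tan_pos_of_pos_of_lt_pi_div_two (by positivity) (by linarith [Real.pi_pos])

/-- Multiplication by the conjugate of `v` separates a vector into its components along and across
the flow, both scaled by the norm of `v`. -/
theorem place_mul_conj (v : ℂ) (ε : ℤˣ) (i : ZMod 5) (s : ℝ) :
    (place ε i s * (starRingEnd ℂ) v).re =
      ((ε : ℤ) : ℝ) * (sideMidpoint i * (starRingEnd ℂ) v).re -
        s * (sideMidpoint i * (starRingEnd ℂ) v).im ∧
    (place ε i s * (starRingEnd ℂ) v).im =
      ((ε : ℤ) : ℝ) * (sideMidpoint i * (starRingEnd ℂ) v).im +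
        s * (sideMidpoint i * (starRingEnd ℂ) v).re := by
  rw [place, mul_assoc]
  generalize sideMidpoint i * (starRingEnd ℂ) v = z
  constructor <;> simp

theorem displacement_eq_iff {v : ℂ} (hv : v ≠ 0) (z : ℂ) (τ : ℝ) :
    z = τ * v ↔ (z * (starRingEnd ℂ) v).im = 0 ∧
      (z * (starRingEnd ℂ) v).re = τ * Complex.normSq v := by
  have hc : (starRingEnd ℂ) v ≠ 0 := by simpa using hv
  have : (τ : ℂ) * v * (starRingEnd ℂ) v = ((τ * Complex.normSq v : ℝ) : ℂ) := by
    rw [mul_assoc, Complex.mul_conj]; push_cast; ring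
  rw [← mul_left_inj' hc, this, Complex.ext_iff, Complex.ofReal_re, Complex.ofReal_im, and_comm]

theorem cos_pi_div_five_eq : Real.cos (Real.pi / 5) = φ / 2 := by
  rw [Real.cos_pi_div_five, Real.goldenRatio]; ring

theorem four_mul_sq_cos_pi_div_five :
    4 * Real.cos (Real.pi / 5) ^ 2 = 2 * Real.cos (Real.pi / 5) + 1 := by
  rw [cos_pi_div_five_eq]
  linear_combination Real.goldenRatio_sq

/-- The midpoints of the sides in terms of the sine and cosine of `36°`. -/
theorem sideMidpoint_eq (i : ZMod 5) : sideMidpoint i =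
    (![⟨Real.sin (Real.pi / 5), Real.cos (Real.pi / 5)⟩, ⟨0, -1⟩,
      ⟨-Real.sin (Real.pi / 5), Real.cos (Real.pi / 5)⟩,
      ⟨2 * Real.sin (Real.pi / 5) * Real.cos (Real.pi / 5), 1 - 2 * Real.cos (Real.pi / 5) ^ 2⟩,
      ⟨-(2 * Real.sin (Real.pi / 5) * Real.cos (Real.pi / 5)),
        1 - 2 * Real.cos (Real.pi / 5) ^ 2⟩] : Fin 5 → ℂ) i := by
  have h2 : ∀ x : ℝ, Complex.exp ((x : ℂ) * Complex.I) = ⟨Real.cos x, Real.sin x⟩ := fun x => by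
    apply Complex.ext <;> simp [Complex.exp_ofReal_mul_I_re, Complex.exp_ofReal_mul_I_im]
  have e0 : ((0 : ZMod 5).val : ℝ) = 0 := by norm_num [ZMod.val]
  have e1 : ((1 : ZMod 5).val : ℝ) = 1 := by rw [show (1 : ZMod 5).val = 1 from rfl]; norm_num
  have e2 : ((2 : ZMod 5).val : ℝ) = 2 := by rw [show (2 : ZMod 5).val = 2 from rfl]; norm_num
  have e3 : ((3 : ZMod 5).val : ℝ) = 3 := by rw [show (3 : ZMod 5).val = 3 from rfl]; norm_num
  have e4 : ((4 : ZMod 5).val : ℝ) = 4 := by rw [show (4 : ZMod 5).val = 4 from rfl]; norm_num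
  unfold sideMidpoint
  rw [h2]
  have hc2 := Real.cos_two_mul (Real.pi / 5)
  have hs2 := Real.sin_two_mul (Real.pi / 5)
  rcases LinearFlow.side_cases i with rfl | rfl | rfl | rfl | rfl
  · rw [e0, show 3 * Real.pi / 10 + 6 * Real.pi / 5 * 0 = Real.pi / 2 - Real.pi / 5 by ring,
      Real.cos_pi_div_two_sub, Real.sin_pi_div_two_sub]
    rfl
  · rw [e1, show 3 * Real.pi / 10 + 6 * Real.pi / 5 * 1 = Real.pi / 2 + Real.pi by ring,
      Real.cos_add_pi, Real.sin_add_pi]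
    simp
  · rw [e2, show 3 * Real.pi / 10 + 6 * Real.pi / 5 * 2 =
      Real.pi / 5 + Real.pi / 2 + 2 * Real.pi by ring,
      Real.cos_add_two_pi, Real.sin_add_two_pi, Real.cos_add_pi_div_two, Real.sin_add_pi_div_two]
    rfl
  · rw [e3, show 3 * Real.pi / 10 + 6 * Real.pi / 5 * 3 =
      2 * (Real.pi / 5) - Real.pi / 2 + 2 * Real.pi + 2 * Real.pi by ring,
      Real.cos_add_two_pi, Real.sin_add_two_pi, Real.cos_add_two_pi, Real.sin_add_two_pi,
      Real.cos_sub_pi_div_two, Real.sin_sub_pi_div_two, hc2, hs2]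
    apply Complex.ext
    · rfl
    · change -(_ - 1) = 1 - _
      ring
  · rw [e4, show 3 * Real.pi / 10 + 6 * Real.pi / 5 * 4 =
      Real.pi / 2 - 2 * (Real.pi / 5) + Real.pi + 2 * Real.pi + 2 * Real.pi by ring,
      Real.cos_add_two_pi, Real.sin_add_two_pi, Real.cos_add_two_pi, Real.sin_add_two_pi,
      Real.cos_add_pi, Real.sin_add_pi,
      Real.cos_pi_div_two_sub, Real.sin_pi_div_two_sub, hc2, hs2]
    apply Complex.ext
    · rfl
    · change -(_ - 1) = 1 - _
      ring

/-- Two different midpoints differ by an angle of 72° or 144° up to sign; the imaginary part is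
squared to forget that sign. -/
theorem sideMidpoint_mul_conj {i j : ZMod 5} (hij : j ≠ i) :
    ((sideMidpoint j * (starRingEnd ℂ) (sideMidpoint i)).re =
        2 * Real.cos (Real.pi / 5) ^ 2 - 1 ∧
      (sideMidpoint j * (starRingEnd ℂ) (sideMidpoint i)).im ^ 2 =
        (2 * Real.sin (Real.pi / 5) * Real.cos (Real.pi / 5)) ^ 2) ∨
    ((sideMidpoint j * (starRingEnd ℂ) (sideMidpoint i)).re = -Real.cos (Real.pi / 5) ∧
      (sideMidpoint j * (starRingEnd ℂ) (sideMidpoint i)).im ^ 2 =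
        Real.sin (Real.pi / 5) ^ 2) := by
  have h1 := four_mul_sq_cos_pi_div_five
  have h2 := Real.sin_sq_add_cos_sq (Real.pi / 5)
  rw [sideMidpoint_eq, sideMidpoint_eq]
  generalize Real.sin (Real.pi / 5) = s at *
  generalize Real.cos (Real.pi / 5) = c at *
  rcases LinearFlow.side_cases i with rfl | rfl | rfl | rfl | rfl <;>
  rcases LinearFlow.side_cases j with rfl | rfl | rfl | rfl | rfl <;>
  first
  | exact absurd rfl hij
  | (simp only [Complex.mul_re, Complex.mul_im, Complex.conj_re, Complex.conj_im, Matrix.cons_val]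
     first
     | (left; constructor <;> grind)
     | (right; constructor <;> grind))
/-- The other points of the pentagon are on the inner side of a side. -/
theorem inner_sideMidpoint_lt {i j : ZMod 5} (hij : j ≠ i) {s : ℝ}
    (hs : |s| < Real.tan (Real.pi / 5)) (ε : ℤˣ) :
    ((ε : ℤ) : ℝ) * (place ε j s * (starRingEnd ℂ) (sideMidpoint i)).re < 1 := by
  have hcos : 0 < Real.cos (Real.pi / 5) :=
    Real.cos_pos_of_mem_Ioo ⟨by linarith [Real.pi_pos], by linarith [Real.pi_pos]⟩
  have hsin : 0 < Real.sin (Real.pi / 5) :=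
    Real.sin_pos_of_pos_of_lt_pi (by positivity) (by linarith [Real.pi_pos])
  have h1 := four_mul_sq_cos_pi_div_five
  have h2 := Real.sin_sq_add_cos_sq (Real.pi / 5)
  have hz := sideMidpoint_mul_conj hij
  rw [Real.tan_eq_sin_div_cos, lt_div_iff₀ hcos] at hs
  rw [(place_mul_conj _ _ _ _).1]
  generalize sideMidpoint j * (starRingEnd ℂ) (sideMidpoint i) = z at *
  have hε : ((ε : ℤ) : ℝ) * ((ε : ℤ) : ℝ) = 1 := by
    rw [← Int.cast_mul, ← Units.val_mul, Int.units_mul_self]; simp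
  have hε' : |((ε : ℤ) : ℝ)| = 1 := by
    rcases Int.units_eq_one_or ε with rfl | rfl <;> simp
  have h3 : ((ε : ℤ) : ℝ) * (((ε : ℤ) : ℝ) * z.re - s * z.im) ≤ z.re + |s| * |z.im| := by
    have h4 := neg_abs_le (((ε : ℤ) : ℝ) * (s * z.im))
    rw [abs_mul, hε', one_mul, abs_mul] at h4
    linear_combination h4 + z.re * hε
  refine h3.trans_lt ?_
  generalize Real.sin (Real.pi / 5) = S at *
  generalize Real.cos (Real.pi / 5) = C at *
  rcases hz with ⟨hre, him⟩ | ⟨hre, him⟩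
  -- Adjacent sides: the bound 1 would be attained at the common vertex, which the strict bound on
  -- `s` excludes.
  · have him : |z.im| = 2 * S * C := by
      rw [← abs_of_pos (show 0 < 2 * S * C by positivity)]
      exact (sq_eq_sq_iff_abs_eq_abs _ _).1 him
    rw [hre, him]
    nlinarith
  · have him : |z.im| = S := by
      rw [← abs_of_pos hsin]
      exact (sq_eq_sq_iff_abs_eq_abs _ _).1 him
    rw [hre, him]
    have h5 : |s| * C * S < S * S := mul_lt_mul_of_pos_right hs hsin
    have h6 : (|s| * S) * C < (1 + C) * C := by nlinarith
    linarith [lt_of_mul_lt_mul_right h6 hcos.le]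

/-- Convexity: projected to the normal of either side, the displacement points inwards at the first
side and outwards at the second. No sign of `τ` is assumed, so the same fact recovers that sign in
the converse half of `step_iff`. -/
theorem mul_sheet_mul_sideMidpoint {v : ℂ} {c c' : Crossing} {τ : ℝ} (hside : c'.side ≠ c.side)
    (hd : displacement c c' = (τ : ℂ) * v) :
    τ * (((c.sheet : ℤ) : ℝ) * (sideMidpoint c.side * (starRingEnd ℂ) v).re) < 0 ∧
      0 < τ * (((c.sheet : ℤ) : ℝ) * (sideMidpoint c'.side * (starRingEnd ℂ) v).re) := by
  have hsymm : ∀ z : ℂ, (v * (starRingEnd ℂ) z).re = (z * (starRingEnd ℂ) v).re := fun z => by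
    simp; ring
  have hself : ∀ (i : ZMod 5) (s : ℝ),
      (place c.sheet i s * (starRingEnd ℂ) (sideMidpoint i)).re = ((c.sheet : ℤ) : ℝ) := by
    intro i s
    rw [(place_mul_conj _ _ _ _).1, Complex.mul_conj]
    have : Complex.normSq (sideMidpoint i) = 1 := by
      rw [Complex.normSq_eq_norm_sq, sideMidpoint, Complex.norm_exp_ofReal_mul_I, one_pow]
    rw [this]
    simp
  have hε : ((c.sheet : ℤ) : ℝ) * ((c.sheet : ℤ) : ℝ) = 1 := by
    rw [← Int.cast_mul, ← Units.val_mul, Int.units_mul_self]; simp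
  have key : ∀ z : ℂ, (place c.sheet c'.side c'.param * (starRingEnd ℂ) z).re -
      (place c.sheet c.side c.param * (starRingEnd ℂ) z).re =
        τ * (z * (starRingEnd ℂ) v).re := by
    intro z
    have h1 := congrArg (fun w => (w * (starRingEnd ℂ) z).re) hd
    simp only [displacement, sub_mul, Complex.sub_re, mul_assoc, Complex.re_ofReal_mul] at h1
    rw [h1, hsymm]
  have h1 := key (sideMidpoint c.side)
  have h2 := key (sideMidpoint c'.side)
  rw [hself] at h1 h2
  have h3 := inner_sideMidpoint_lt hside c'.abs_param_lt c.sheet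
  have h4 := inner_sideMidpoint_lt hside.symm c.abs_param_lt c.sheet
  constructor
  · have : τ * (((c.sheet : ℤ) : ℝ) * (sideMidpoint c.side * (starRingEnd ℂ) v).re) =
        ((c.sheet : ℤ) : ℝ) * (τ * (sideMidpoint c.side * (starRingEnd ℂ) v).re) := by ring
    rw [this, ← h1]
    linarith
  · have : τ * (((c.sheet : ℤ) : ℝ) * (sideMidpoint c'.side * (starRingEnd ℂ) v).re) =
        ((c.sheet : ℤ) : ℝ) * (τ * (sideMidpoint c'.side * (starRingEnd ℂ) v).re) := by ring
    rw [this, ← h2]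
    linarith

theorem displacement_mul_conj (v : ℂ) (c c' : Crossing) :
    (displacement c c' * (starRingEnd ℂ) v).re =
      (((c.sheet : ℤ) : ℝ) * (sideMidpoint c'.side * (starRingEnd ℂ) v).re -
        c'.param * (sideMidpoint c'.side * (starRingEnd ℂ) v).im) -
      (((c.sheet : ℤ) : ℝ) * (sideMidpoint c.side * (starRingEnd ℂ) v).re -
        c.param * (sideMidpoint c.side * (starRingEnd ℂ) v).im) ∧
    (displacement c c' * (starRingEnd ℂ) v).im =
      (((c.sheet : ℤ) : ℝ) * (sideMidpoint c'.side * (starRingEnd ℂ) v).im +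
        c'.param * (sideMidpoint c'.side * (starRingEnd ℂ) v).re) -
      (((c.sheet : ℤ) : ℝ) * (sideMidpoint c.side * (starRingEnd ℂ) v).im +
        c.param * (sideMidpoint c.side * (starRingEnd ℂ) v).re) := by
  rw [displacement, sub_mul, Complex.sub_re, Complex.sub_im, (place_mul_conj _ _ _ _).1,
    (place_mul_conj _ _ _ _).1, (place_mul_conj _ _ _ _).2, (place_mul_conj _ _ _ _).2]
  exact ⟨rfl, rfl⟩

theorem step_iff {v : ℂ} (hv : v ≠ 0) {c c' : Crossing} : Step v c c' ↔
    c'.sheet = -c.sheet ∧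
    ((c.sheet : ℤ) : ℝ) * (sideMidpoint c.side * (starRingEnd ℂ) v).re < 0 ∧
    0 < ((c.sheet : ℤ) : ℝ) * (sideMidpoint c'.side * (starRingEnd ℂ) v).re ∧
    (displacement c c' * (starRingEnd ℂ) v).im = 0 := by
  constructor
  · rintro ⟨h1, hside, τ, hτ, hd⟩
    obtain ⟨h2, h3⟩ := mul_sheet_mul_sideMidpoint hside hd
    exact ⟨h1, neg_of_mul_neg_right h2 hτ.le, (mul_pos_iff_of_pos_left hτ).1 h3,
      ((displacement_eq_iff hv _ _).1 hd).1⟩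
  · rintro ⟨h1, h2, h3, h4⟩
    have hside : c'.side ≠ c.side := fun h => by
      rw [h] at h3
      exact lt_asymm h2 h3
    have hn : 0 < Complex.normSq v := Complex.normSq_pos.2 hv
    set τ := (displacement c c' * (starRingEnd ℂ) v).re / Complex.normSq v with hτ
    have hd : displacement c c' = τ * v :=
      (displacement_eq_iff hv _ _).2 ⟨h4, by rw [hτ, div_mul_cancel₀ _ hn.ne']⟩
    exact ⟨h1, hside, τ, (pos_iff_pos_of_mul_pos
      (mul_sheet_mul_sideMidpoint hside hd).2).2 h3, hd⟩

/-! ### Crossings as states of a flow -/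

open LinearFlow

variable {v : ℂ}

/-- A state of the flow, as a crossing. -/
def stateCrossing (v : ℂ) (c : ZMod 5 × ℝ) (h : (directionFlow v).Admits c) : Crossing where
  -- The trajectory enters the pentagon whose outward normal at this side points against `v`; hence
  -- states need not record the pentagon.
  sheet := if (sideMidpoint c.1 * (starRingEnd ℂ) v).re < 0 then 1 else -1
  side := c.1
  param := -c.2 / (sideMidpoint c.1 * (starRingEnd ℂ) v).re
  abs_param_lt := by
    simp only [Admits, directionFlow, abs_mul, abs_of_pos tan_pi_div_five_pos] at h
    have h0 : 0 < |(sideMidpoint c.1 * (starRingEnd ℂ) v).re| :=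
      (mul_pos_iff_of_pos_left tan_pi_div_five_pos).1 ((abs_nonneg _).trans_lt h)
    rwa [abs_div, abs_neg, div_lt_iff₀ h0]

theorem re_ne_zero_of_admits {c : ZMod 5 × ℝ} (h : (directionFlow v).Admits c) :
    (sideMidpoint c.1 * (starRingEnd ℂ) v).re ≠ 0 := by
  intro h0
  simp only [Admits, directionFlow, h0, mul_zero, abs_zero] at h
  exact absurd h (not_lt.2 (abs_nonneg _))

theorem crossingState_stateCrossing {c : ZMod 5 × ℝ} (h : (directionFlow v).Admits c) :
    crossingState v (stateCrossing v c h) = c := by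
  refine Prod.ext rfl ?_
  simp only [crossingState, stateCrossing]
  rw [mul_div_cancel₀ _ (re_ne_zero_of_admits h), neg_neg]

theorem Crossing.eq_of_fields {c c' : Crossing} (h1 : c.sheet = c'.sheet) (h2 : c.side = c'.side)
    (h3 : c.param = c'.param) : c = c' := by
  cases c; cases c'; cases h1; cases h2; cases h3; rfl

theorem eq_of_crossingState_eq {c c' : Crossing} (h : crossingState v c = crossingState v c')
    (hc : ((c.sheet : ℤ) : ℝ) * (sideMidpoint c.side * (starRingEnd ℂ) v).re < 0)
    (hc' : ((c'.sheet : ℤ) : ℝ) * (sideMidpoint c'.side * (starRingEnd ℂ) v).re < 0) :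
    c = c' := by
  obtain ⟨h1, h2⟩ := Prod.ext_iff.1 h
  simp only [crossingState] at h1 h2
  have h0 : (sideMidpoint c.side * (starRingEnd ℂ) v).re ≠ 0 := fun h0 => by
    rw [h0, mul_zero] at hc
    exact lt_irrefl _ hc
  rw [← h1] at h2 hc'
  refine Crossing.eq_of_fields ?_ h1 (mul_left_cancel₀ h0 (neg_inj.1 h2))
  rcases Int.units_eq_one_or c.sheet with e | e <;>
  rcases Int.units_eq_one_or c'.sheet with e' | e' <;>
  rw [e] at hc ⊢ <;> rw [e'] at hc' ⊢ <;> simp at hc hc' <;> exfalso <;> linarith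

theorem admits_crossingState {c : Crossing}
    (hc : ((c.sheet : ℤ) : ℝ) * (sideMidpoint c.side * (starRingEnd ℂ) v).re < 0) :
    (directionFlow v).Admits (crossingState v c) := by
  have h0 : (sideMidpoint c.side * (starRingEnd ℂ) v).re ≠ 0 := fun h0 => by
    rw [h0, mul_zero] at hc
    exact lt_irrefl _ hc
  simp only [Admits, directionFlow, crossingState, abs_neg, abs_mul,
    abs_of_pos tan_pi_div_five_pos]
  rw [mul_comm]
  exact mul_lt_mul_of_pos_right c.abs_param_lt (abs_pos.2 h0)

theorem next_crossingState (hv : v ≠ 0) {c c' : Crossing} (h : Step v c c') :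
    (directionFlow v).Next (crossingState v c) (crossingState v c') := by
  obtain ⟨-, h2, h3, h4⟩ := (step_iff hv).1 h
  rw [(displacement_mul_conj v c c').2] at h4
  simp only [Next, directionFlow, crossingState]
  generalize sideMidpoint c.side * (starRingEnd ℂ) v = z at *
  generalize sideMidpoint c'.side * (starRingEnd ℂ) v = z' at *
  rcases Int.units_eq_one_or c.sheet with e | e <;> rw [e] at h2 h3 h4 <;> simp at h2 h3 h4
  · exact Or.inl ⟨mul_neg_of_pos_of_neg tan_pi_div_five_pos (by simpa using h2),
      mul_pos tan_pi_div_five_pos (by simpa using h3), by simp; linarith⟩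
  · exact Or.inr ⟨mul_pos tan_pi_div_five_pos (by simpa using h2),
      mul_neg_of_pos_of_neg tan_pi_div_five_pos (by simpa using h3), by simp; linarith⟩

theorem step_stateCrossing (hv : v ≠ 0) {c c' : ZMod 5 × ℝ} (hc : (directionFlow v).Admits c)
    (hc' : (directionFlow v).Admits c') (h : (directionFlow v).Next c c') :
    Step v (stateCrossing v c hc) (stateCrossing v c' hc') := by
  rw [step_iff hv, (displacement_mul_conj v _ _).2]
  have hT := tan_pi_div_five_pos
  have h0 := re_ne_zero_of_admits hc
  have h0' := re_ne_zero_of_admits hc'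
  simp only [Next, directionFlow, mul_pos_iff_of_pos_left hT] at h
  simp only [stateCrossing, div_mul_cancel₀ _ h0, div_mul_cancel₀ _ h0']
  clear h0 h0'
  generalize sideMidpoint c.1 * (starRingEnd ℂ) v = z at *
  generalize sideMidpoint c'.1 * (starRingEnd ℂ) v = z' at *
  rcases h with ⟨h1, h2, h3⟩ | ⟨h1, h2, h3⟩
  · have h1 := neg_of_mul_neg_right h1 hT.le
    rw [if_pos h1, if_neg (not_lt.2 h2.le)]
    refine ⟨rfl, ?_, ?_, ?_⟩
    · simpa using h1
    · simpa using h2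
    · simp; linarith
  · have h2 := neg_of_mul_neg_right h2 hT.le
    rw [if_neg (not_lt.2 h1.le), if_pos h2]
    refine ⟨by simp, ?_, ?_, ?_⟩
    · simpa using h1
    · simpa using h2
    · simp; linarith

/-- The component of the displacement along `v`. The bracket is a difference of values at the two
crossings and disappears around a closed trajectory. -/
theorem norm_displacement_mul_norm (hv : v ≠ 0) {c c' : Crossing} (h : Step v c c') :
    ‖displacement c c'‖ * ‖v‖ =
      |(sideMidpoint c.side * (starRingEnd ℂ) v).re| +
      |(sideMidpoint c'.side * (starRingEnd ℂ) v).re| +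
      (c.param * (sideMidpoint c.side * (starRingEnd ℂ) v).im -
        c'.param * (sideMidpoint c'.side * (starRingEnd ℂ) v).im) := by
  obtain ⟨-, h2, h3, -⟩ := (step_iff hv).1 h
  obtain ⟨-, -, τ, hτ, hd⟩ := h
  have h1 := ((displacement_eq_iff hv _ _).1 hd).2
  rw [(displacement_mul_conj v c c').1] at h1
  have h4 : ‖displacement c c'‖ * ‖v‖ = τ * Complex.normSq v := by
    rw [hd, norm_mul, Complex.norm_real, Real.norm_of_nonneg hτ.le, Complex.normSq_eq_norm_sq]
    ring
  have e1 : |(sideMidpoint c.side * (starRingEnd ℂ) v).re| =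
      -(((c.sheet : ℤ) : ℝ) * (sideMidpoint c.side * (starRingEnd ℂ) v).re) := by
    rw [← abs_of_neg h2, abs_mul]
    rcases Int.units_eq_one_or c.sheet with e | e <;> simp [e]
  have e2 : |(sideMidpoint c'.side * (starRingEnd ℂ) v).re| =
      ((c.sheet : ℤ) : ℝ) * (sideMidpoint c'.side * (starRingEnd ℂ) v).re := by
    rw [← abs_of_pos h3, abs_mul]
    rcases Int.units_eq_one_or c.sheet with e | e <;> simp [e]
  rw [h4, ← h1, e1, e2]
  ring

/-- The cycle of the linear flow described by a closed trajectory. -/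
def ClosedTrajectory.toCycle (hv : v ≠ 0) (γ : ClosedTrajectory v) :
    Cycle (directionFlow v) where
  period := γ.period
  period_pos := γ.period_pos
  state n := crossingState v (γ.crossing n)
  admits n := admits_crossingState ((step_iff hv).1 (γ.step n)).2.1
  next n := next_crossingState hv (γ.step n)
  closes_up n := by rw [γ.closes_up]
  traversed_once m h0 h1 h := γ.traversed_once m h0 h1 (eq_of_crossingState_eq h
    ((step_iff hv).1 (γ.step m)).2.1 ((step_iff hv).1 (γ.step 0)).2.1)

/-- The closed trajectory described by a cycle of the linear flow. -/
def LinearFlow.Cycle.toClosedTrajectory (hv : v ≠ 0) (o : Cycle (directionFlow v)) :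
    ClosedTrajectory v where
  period := o.period
  period_pos := o.period_pos
  crossing n := stateCrossing v (o.state n) (o.admits n)
  step n := step_stateCrossing hv _ _ (o.next n)
  closes_up n := by simp only [o.closes_up]
  traversed_once m h0 h1 h := o.traversed_once m h0 h1 (by
    rw [← crossingState_stateCrossing (o.admits m), h, crossingState_stateCrossing])

/-- Every crossing is an end of two segments, so its width is counted twice. -/
theorem ClosedTrajectory.length_mul_norm (hv : v ≠ 0) (γ : ClosedTrajectory v) :
    Real.tan (Real.pi / 5) * (γ.length * ‖v‖) = 2 * (γ.toCycle hv).weight := by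
  have h0 : γ.crossing γ.period = γ.crossing 0 := by simpa using γ.closes_up 0
  have h1 : ∑ n ∈ Finset.range γ.period, ‖displacement (γ.crossing n) (γ.crossing (n + 1))‖ * ‖v‖ =
      _ := Finset.sum_congr rfl fun n _ => norm_displacement_mul_norm hv (γ.step n)
  have h2 := (γ.toCycle hv).sum_range_succ_period (fun c => |(directionFlow v).width c.1|)
  have h3 := Finset.sum_range_sub' (fun n => (γ.crossing n).param *
    (sideMidpoint (γ.crossing n).side * (starRingEnd ℂ) v).im) γ.period
  rw [h0, sub_self] at h3
  rw [length, Finset.sum_mul, h1, Finset.sum_add_distrib, h3, add_zero, Finset.sum_add_distrib,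
    mul_add, Finset.mul_sum, Finset.mul_sum, two_mul]
  have e : ∀ c : Crossing, Real.tan (Real.pi / 5) *
      |(sideMidpoint c.side * (starRingEnd ℂ) v).re| =
        |(directionFlow v).width (crossingState v c).1| := fun c => by
    simp only [directionFlow, abs_mul, abs_of_pos tan_pi_div_five_pos, crossingState]
  simp only [e]
  exact congrArg₂ (· + ·) rfl h2

theorem LinearFlow.Cycle.weight_toCycle_toClosedTrajectory (hv : v ≠ 0)
    (o : Cycle (directionFlow v)) :
    ((o.toClosedTrajectory hv).toCycle hv).weight = o.weight := by
  refine Finset.sum_congr rfl fun n _ => ?_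
  rfl

/-! ### The coordinate of a direction -/

/-- The end `α = 1 - φ / 2` of the principal sector. -/
def sectorEnd : ℝ := 1 - φ / 2

theorem sectorEnd_pos : 0 < sectorEnd := by
  unfold sectorEnd
  linarith [goldenRatio_lt]

theorem directionVector_eq (t : ℝ) : directionVector t =
    ⟨-(2 * Real.sin (Real.pi / 5) * Real.cos (Real.pi / 5)) * Real.sin (Real.pi / 5) -
        (2 * Real.cos (Real.pi / 5) ^ 2 - 1) * t,
      -(2 * Real.sin (Real.pi / 5) * Real.cos (Real.pi / 5)) * t +
        (2 * Real.cos (Real.pi / 5) ^ 2 - 1) * Real.sin (Real.pi / 5)⟩ := by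
  rw [directionVector, show 9 * Real.pi / 10 = Real.pi - (Real.pi / 2 - 2 * (Real.pi / 5)) by ring]
  have h : ∀ x : ℝ, Complex.exp ((x : ℂ) * Complex.I) = ⟨Real.cos x, Real.sin x⟩ := fun x => by
    apply Complex.ext <;> simp [Complex.exp_ofReal_mul_I_re, Complex.exp_ofReal_mul_I_im]
  rw [h, Real.cos_pi_sub, Real.sin_pi_sub, Real.cos_pi_div_two_sub, Real.sin_pi_div_two_sub,
    Real.cos_two_mul, Real.sin_two_mul]
  generalize Real.sin (Real.pi / 5) = s
  generalize Real.cos (Real.pi / 5) = c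
  apply Complex.ext <;> simp

theorem sin_pi_div_five_pos : 0 < Real.sin (Real.pi / 5) :=
  Real.sin_pos_of_pos_of_lt_pi (by positivity) (by linarith [Real.pi_pos])

theorem directionVector_ne_zero (t : ℝ) : directionVector t ≠ 0 := by
  rw [directionVector]
  refine mul_ne_zero (Complex.exp_ne_zero _) fun h => ?_
  have h1 := congrArg Complex.re h
  simp only [Complex.add_re, Complex.mul_re, Complex.ofReal_re, Complex.ofReal_im, Complex.I_re,
    Complex.I_im, Complex.zero_re, mul_zero, zero_mul, sub_zero, add_zero] at h1
  exact sin_pi_div_five_pos.ne' h1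

theorem similar_directionFlow (t : ℝ) :
    Similar 0 (sectorFlow (sectorEnd - t) (sectorEnd + t)) (directionFlow (directionVector t)) := by
  have hcos : Real.cos (Real.pi / 5) ≠ 0 := by
    rw [cos_pi_div_five_eq]
    linarith [goldenRatio_gt]
  have hT : Real.tan (Real.pi / 5) * Real.cos (Real.pi / 5) = Real.sin (Real.pi / 5) :=
    Real.tan_mul_cos hcos
  have hφ : φ = 2 * Real.cos (Real.pi / 5) := by
    rw [cos_pi_div_five_eq]; ring
  have h1 := four_mul_sq_cos_pi_div_five
  have h2 := Real.sin_sq_add_cos_sq (Real.pi / 5)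
  have h3 := sin_pi_div_five_pos
  -- The factor is read off from side 1, whose width is `-x`. The translation is its position, since
  -- `sectorFlow` places side 1 at the origin.
  refine ⟨2 * Real.sin (Real.pi / 5) ^ 2, by positivity,
    (directionFlow (directionVector t)).position 1, fun i => ?_⟩
  rw [add_zero]
  simp only [directionFlow, directionVector_eq, sideMidpoint_eq]
  generalize Real.tan (Real.pi / 5) = T at *
  generalize Real.sin (Real.pi / 5) = s at *
  generalize Real.cos (Real.pi / 5) = c at *
  rcases LinearFlow.side_cases i with rfl | rfl | rfl | rfl | rfl <;>
  simp only [Complex.mul_re, Complex.mul_im, Complex.conj_re, Complex.conj_im, Matrix.cons_val,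
    sectorFlow_width_zero, sectorFlow_width_one, sectorFlow_width_two, sectorFlow_width_three,
    sectorFlow_width_four, sectorFlow_position_zero, sectorFlow_position_one,
    sectorFlow_position_two, sectorFlow_position_three, sectorFlow_position_four, sectorEnd, hφ] <;>
  clear hφ h3 <;>
  constructor <;> grind

/-- The half-widths that bound the four sectors outside the principal one, in terms of those
of the sides `1` and `5`: the boundaries between these sectors are where consecutive ones of them
are the coordinates of the end of the principal sector. -/
def sectorRay (x y : ℝ) : ℕ → ℝ
  | 0 => y
  | 1 => x + φ * y
  | 2 => φ * x + φ * y
  | 3 => φ * x + y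
  | _ => x

theorem sectorRay_nonneg {x y : ℝ} (hx : 0 ≤ x) (hy : 0 ≤ y) (n : ℕ) : 0 ≤ sectorRay x y n := by
  have := goldenRatio_gt
  unfold sectorRay
  split <;> positivity

theorem sectorRay_add_pos {x y : ℝ} (hx : 0 ≤ x) (hy : 0 ≤ y) (hxy : 0 < x + y) {j : ℕ}
    (h1 : 1 ≤ j) (h4 : j ≤ 4) : 0 < sectorRay x y (j - 1) + sectorRay x y j := by
  have hφ := goldenRatio_gt
  have h2 : 0 ≤ (φ - 1) * x := mul_nonneg (by linarith) hx
  have h3 : 0 ≤ (φ - 1) * y := mul_nonneg (by linarith) hy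
  interval_cases j <;> simp only [Nat.reduceSub, sectorRay] <;> linarith

/-- `sectorRay x y n` is the half-width of the side with label `-n`. After the shift, sides 1 and 5
inherit the widths of `1 - j` and `-j`, that is, two consecutive rays. These have opposite signs,
hence the negated second argument. The factor `1` or `-1` makes the width of side 1 negative or
zero, as in `sectorFlow`. -/
theorem similar_rotation (x y : ℝ) {j : ℕ} (h1 : 1 ≤ j) (h4 : j ≤ 4) :
    Similar (j : ZMod 5) (sectorFlow x y)
      (sectorFlow (sectorRay x y (j - 1)) (-sectorRay x y j)) := by
  have hsq := Real.goldenRatio_sq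
  have key : ∀ (j : ZMod 5) (k X Y : ℝ), k ≠ 0 → (∀ i i', i + j = i' →
      (sectorFlow X (-Y)).width i' = k * (sectorFlow x y).width i ∧
        (sectorFlow X (-Y)).position i' =
          k * (sectorFlow x y).position i + (sectorFlow X (-Y)).position (1 + j)) →
      Similar j (sectorFlow x y) (sectorFlow X (-Y)) := fun j k X Y hk h =>
    ⟨k, hk, (sectorFlow X (-Y)).position (1 + j), fun i => h i _ rfl⟩
  interval_cases j <;> simp only [Nat.reduceSub, sectorRay, Nat.cast_one, Nat.cast_ofNat]
  · refine key 1 1 _ _ one_ne_zero fun i i' h => ?_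
    rw [show (1 + 1 : ZMod 5) = 2 from rfl]
    rcases LinearFlow.side_cases i with rfl | rfl | rfl | rfl | rfl <;>
    rcases LinearFlow.side_cases i' with rfl | rfl | rfl | rfl | rfl <;>
    first
    | exact absurd h (by decide)
    | (simp only [sectorFlow_width_zero, sectorFlow_width_one, sectorFlow_width_two,
        sectorFlow_width_three, sectorFlow_width_four, sectorFlow_position_zero,
        sectorFlow_position_one, sectorFlow_position_two, sectorFlow_position_three,
        sectorFlow_position_four]
       constructor <;> grind)
  · refine key 2 (-1) _ _ (by norm_num) fun i i' h => ?_
    rw [show (1 + 2 : ZMod 5) = 3 from rfl]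
    rcases LinearFlow.side_cases i with rfl | rfl | rfl | rfl | rfl <;>
    rcases LinearFlow.side_cases i' with rfl | rfl | rfl | rfl | rfl <;>
    first
    | exact absurd h (by decide)
    | (simp only [sectorFlow_width_zero, sectorFlow_width_one, sectorFlow_width_two,
        sectorFlow_width_three, sectorFlow_width_four, sectorFlow_position_zero,
        sectorFlow_position_one, sectorFlow_position_two, sectorFlow_position_three,
        sectorFlow_position_four]
       constructor <;> grind)
  · refine key 3 1 _ _ one_ne_zero fun i i' h => ?_
    rw [show (1 + 3 : ZMod 5) = 4 from rfl]
    rcases LinearFlow.side_cases i with rfl | rfl | rfl | rfl | rfl <;>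
    rcases LinearFlow.side_cases i' with rfl | rfl | rfl | rfl | rfl <;>
    first
    | exact absurd h (by decide)
    | (simp only [sectorFlow_width_zero, sectorFlow_width_one, sectorFlow_width_two,
        sectorFlow_width_three, sectorFlow_width_four, sectorFlow_position_zero,
        sectorFlow_position_one, sectorFlow_position_two, sectorFlow_position_three,
        sectorFlow_position_four]
       constructor <;> grind)
  · refine key 4 (-1) _ _ (by norm_num) fun i i' h => ?_
    rw [show (1 + 4 : ZMod 5) = 0 from rfl]
    rcases LinearFlow.side_cases i with rfl | rfl | rfl | rfl | rfl <;>
    rcases LinearFlow.side_cases i' with rfl | rfl | rfl | rfl | rfl <;>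
    first
    | exact absurd h (by decide)
    | (simp only [sectorFlow_width_zero, sectorFlow_width_one, sectorFlow_width_two,
        sectorFlow_width_three, sectorFlow_width_four, sectorFlow_position_zero,
        sectorFlow_position_one, sectorFlow_position_two, sectorFlow_position_three,
        sectorFlow_position_four]
       constructor <;> grind)

theorem similar_sectorFlow_smul {k : ℝ} (hk : k ≠ 0) (x y : ℝ) :
    Similar 0 (sectorFlow x y) (sectorFlow (k * x) (k * y)) := by
  refine ⟨k, hk, 0, fun i => ?_⟩
  rw [add_zero]
  rcases LinearFlow.side_cases i with rfl | rfl | rfl | rfl | rfl <;>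
  simp only [sectorFlow_width_zero, sectorFlow_width_one, sectorFlow_width_two,
    sectorFlow_width_three, sectorFlow_width_four, sectorFlow_position_zero,
    sectorFlow_position_one, sectorFlow_position_two, sectorFlow_position_three,
    sectorFlow_position_four] <;>
  constructor <;> ring

theorem shiftWord_zero : shiftWord 0 = id := by
  funext w
  simp [shiftWord]

theorem LinearFlow.Similar.renormalizes_id {D E : LinearFlow} (h : Similar 0 D E) :
    Renormalizes D E id ∧ Renormalizes E D id := by
  have h' : Similar ((0 : ℕ) : ZMod 5) D E := by simpa using h
  have h'' : Similar ((0 : ℕ) : ZMod 5) E D := by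
    obtain ⟨k, hk, d, hd⟩ := h
    refine ⟨k⁻¹, inv_ne_zero hk, -(k⁻¹ * d), fun i => ?_⟩
    simpa using Similar.inverse_data hk hd i
  rw [← shiftWord_zero]
  exact ⟨h'.renormalizes, h''.renormalizes⟩

/-! ### Renormalization as a map of the principal sector -/

/-- The coordinate of the direction `t`, rotated by `j` sectors and reflected into the principal
sector. -/
def sectorMap (j : ℕ) (t : ℝ) : ℝ :=
  sectorEnd * (sectorRay (sectorEnd - t) (sectorEnd + t) j -
      sectorRay (sectorEnd - t) (sectorEnd + t) (j - 1)) /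
    (sectorRay (sectorEnd - t) (sectorEnd + t) (j - 1) +
      sectorRay (sectorEnd - t) (sectorEnd + t) j)

/-- The flow in the direction with the coordinate `t` of the principal sector. -/
def principalFlow (t : ℝ) : LinearFlow := sectorFlow (sectorEnd - t) (sectorEnd + t)

theorem sectorMap_mem {j : ℕ} (h1 : 1 ≤ j) (h4 : j ≤ 4) {t : ℝ}
    (ht : t ∈ Set.Icc (-sectorEnd) sectorEnd) :
    sectorMap j t ∈ Set.Icc (-sectorEnd) sectorEnd := by
  have hx : 0 ≤ sectorEnd - t := by linarith [ht.2]
  have hy : 0 ≤ sectorEnd + t := by linarith [ht.1]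
  have hα := sectorEnd_pos
  have h := sectorRay_add_pos hx hy (by linarith) h1 h4
  have hX := sectorRay_nonneg hx hy (j - 1)
  have hY := sectorRay_nonneg hx hy j
  unfold sectorMap
  constructor
  · rw [le_div_iff₀ h]
    nlinarith
  · rw [div_le_iff₀ h]
    nlinarith

theorem renormalizes_sectorMap {j : ℕ} (h1 : 1 ≤ j) (h4 : j ≤ 4) {t : ℝ}
    (ht : t ∈ Set.Icc (-sectorEnd) sectorEnd) :
    Renormalizes (principalFlow t) (principalFlow (sectorMap j t))
      (fun w => enhance (shiftWord j w)) := by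
  have hx : 0 ≤ sectorEnd - t := by linarith [ht.2]
  have hy : 0 ≤ sectorEnd + t := by linarith [ht.1]
  have hα := sectorEnd_pos
  have h := sectorRay_add_pos hx hy (by linarith) h1 h4
  have hX := sectorRay_nonneg hx hy (j - 1)
  have hY := sectorRay_nonneg hx hy j
  have r1 := (similar_rotation (sectorEnd - t) (sectorEnd + t) h1 h4).renormalizes
  have r2 := renormalizes_enhance hX hY h
  -- The factor normalizes the sum of the two half-widths to `2 * sectorEnd`, the sum of `sectorEnd
  -- - t` and `sectorEnd + t`.
  have r3 := (similar_sectorFlow_smul (k := 2 * sectorEnd /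
    (sectorRay (sectorEnd - t) (sectorEnd + t) (j - 1) +
      sectorRay (sectorEnd - t) (sectorEnd + t) j)) (by positivity)
    (sectorRay (sectorEnd - t) (sectorEnd + t) (j - 1))
    (sectorRay (sectorEnd - t) (sectorEnd + t) j)).renormalizes_id.1
  have e1 : sectorEnd - sectorMap j t = 2 * sectorEnd /
    (sectorRay (sectorEnd - t) (sectorEnd + t) (j - 1) +
      sectorRay (sectorEnd - t) (sectorEnd + t) j) *
      sectorRay (sectorEnd - t) (sectorEnd + t) (j - 1) := by
    rw [sectorMap]
    generalize sectorRay (sectorEnd - t) (sectorEnd + t) (j - 1) = X at *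
    generalize sectorRay (sectorEnd - t) (sectorEnd + t) j = Y at *
    generalize sectorEnd = a at *
    field_simp
    ring
  have e2 : sectorEnd + sectorMap j t = 2 * sectorEnd /
    (sectorRay (sectorEnd - t) (sectorEnd + t) (j - 1) +
      sectorRay (sectorEnd - t) (sectorEnd + t) j) *
      sectorRay (sectorEnd - t) (sectorEnd + t) j := by
    rw [sectorMap]
    generalize sectorRay (sectorEnd - t) (sectorEnd + t) (j - 1) = X at *
    generalize sectorRay (sectorEnd - t) (sectorEnd + t) j = Y at *
    generalize sectorEnd = a at *
    field_simp
    ring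
  rw [← e1, ← e2] at r3
  exact (r1.trans r2).trans r3

theorem hasGoldenWeights_sectorEnd : (principalFlow sectorEnd).HasGoldenWeights := by
  rw [principalFlow, sub_self]
  exact hasGoldenWeights_sectorFlow_zero (by linarith [sectorEnd_pos])

/-- In the flow, the cycles are ordered in the same way as the closed trajectories. -/
theorem atMostAsLong_iff {t : ℝ} (ht : t ∈ Set.Icc (-sectorEnd) sectorEnd)
    (hD : (principalFlow t).HasGoldenWeights) (γ γ' : ClosedTrajectory (directionVector t)) :
    γ.AtMostAsLong γ' ↔ (γ.toCycle (directionVector_ne_zero t)).weight ≤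
      (γ'.toCycle (directionVector_ne_zero t)).weight := by
  have hv := directionVector_ne_zero t
  have hα := sectorEnd_pos
  have hx : 0 ≤ sectorEnd - t := by linarith [ht.2]
  have hy : 0 ≤ sectorEnd + t := by linarith [ht.1]
  -- The similarity with the principal flow preserves words, so periods are compared there as
  -- lengths of words.
  have hperiod : ∀ o o' : Cycle (directionFlow (directionVector t)), o.weight ≤ o'.weight →
      o.period ≤ o'.period := by
    obtain ⟨κ, hκ, h, -⟩ := (similar_directionFlow t).renormalizes_id.2
    intro o o' hle
    obtain ⟨o1, hw, hl⟩ := h o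
    obtain ⟨o1', hw', hl'⟩ := h o'
    have := Cycle.period_le_period hx hy (by linarith) hD o1 o1'
      (by rw [hl, hl']; exact mul_le_mul_of_nonneg_left hle hκ.le)
    rwa [← o1.length_word, ← o1'.length_word, hw, hw', id, id, o.length_word, o'.length_word]
      at this
  have hlen : γ.length ≤ γ'.length ↔ (γ.toCycle hv).weight ≤ (γ'.toCycle hv).weight := by
    have h1 := γ.length_mul_norm hv
    have h2 := γ'.length_mul_norm hv
    have hT := tan_pi_div_five_pos
    have hn : 0 < ‖directionVector t‖ := norm_pos_iff.2 hv
    have e1 : (γ.toCycle hv).weight =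
        Real.tan (Real.pi / 5) * ‖directionVector t‖ / 2 * γ.length := by linarith
    have e2 : (γ'.toCycle hv).weight =
        Real.tan (Real.pi / 5) * ‖directionVector t‖ / 2 * γ'.length := by linarith
    rw [e1, e2, mul_le_mul_iff_right₀ (by positivity)]
  constructor
  · rintro (h | ⟨-, h⟩)
    · by_contra! hlt
      exact absurd (hperiod _ _ hlt.le) (not_le.2 h)
    · exact hlen.1 h
  · intro h
    rcases (hperiod _ _ h).lt_or_eq with h1 | h1
    · exact Or.inl h1
    · exact Or.inr ⟨h1, hlen.2 h⟩

theorem isShortOrbit_iff {t : ℝ} (ht : t ∈ Set.Icc (-sectorEnd) sectorEnd)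
    (hD : (principalFlow t).HasGoldenWeights) (w : List (ZMod 5)) :
    IsShortOrbit t w ↔ (principalFlow t).IsLeastWord w := by
  have hv := directionVector_ne_zero t
  have h1 : IsShortOrbit t w ↔ (directionFlow (directionVector t)).IsLeastWord w := by
    constructor
    · rintro ⟨γ, hw, h⟩
      refine ⟨γ.toCycle hv, hw, fun o => ?_⟩
      have := (atMostAsLong_iff ht hD γ (o.toClosedTrajectory hv)).1 (h _)
      rwa [o.weight_toCycle_toClosedTrajectory] at this
    · rintro ⟨o, hw, h⟩
      refine ⟨o.toClosedTrajectory hv, hw, fun γ => ?_⟩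
      rw [atMostAsLong_iff ht hD, o.weight_toCycle_toClosedTrajectory]
      exact h _
  rw [h1]
  obtain ⟨r1, r2⟩ := (similar_directionFlow t).renormalizes_id
  exact ⟨r2.isLeastWord, r1.isLeastWord⟩

theorem isLongOrbit_iff {t : ℝ} (ht : t ∈ Set.Icc (-sectorEnd) sectorEnd)
    (hD : (principalFlow t).HasGoldenWeights) (w : List (ZMod 5)) :
    IsLongOrbit t w ↔ (principalFlow t).IsGreatestWord w := by
  have hv := directionVector_ne_zero t
  have h1 : IsLongOrbit t w ↔ (directionFlow (directionVector t)).IsGreatestWord w := by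
    constructor
    · rintro ⟨γ, hw, h⟩
      refine ⟨γ.toCycle hv, hw, fun o => ?_⟩
      have := (atMostAsLong_iff ht hD (o.toClosedTrajectory hv) γ).1 (h _)
      rwa [o.weight_toCycle_toClosedTrajectory] at this
    · rintro ⟨o, hw, h⟩
      refine ⟨o.toClosedTrajectory hv, hw, fun γ => ?_⟩
      rw [atMostAsLong_iff ht hD, o.weight_toCycle_toClosedTrajectory]
      exact h _
  rw [h1]
  obtain ⟨r1, r2⟩ := (similar_directionFlow t).renormalizes_id
  exact ⟨r2.isGreatestWord, r1.isGreatestWord⟩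

/-! ### Ideal pentagons -/

/-- As an inversion centred at the midpoint of `p` and `q`, the reflection is visibly decreasing on
each side of that midpoint. -/
theorem geodesicReflection_eq_add_div {p q x : ℝ} (hx : 2 * x - (p + q) ≠ 0) :
    geodesicReflection p q x = (p + q) / 2 + (p - q) ^ 2 / (2 * (2 * x - (p + q))) := by
  rw [geodesicReflection, div_add_div _ _ two_ne_zero (mul_ne_zero two_ne_zero hx),
    div_eq_div_iff hx (mul_ne_zero two_ne_zero (mul_ne_zero two_ne_zero hx))]
  ring

theorem geodesicReflection_lt_of_le_of_lt {p q x x' : ℝ} (hqp : q < p) (h : p ≤ x') (h' : x' < x) :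
    geodesicReflection p q x < geodesicReflection p q x' := by
  rw [geodesicReflection_eq_add_div (by linarith), geodesicReflection_eq_add_div (by linarith)]
  have h1 : 0 < (p - q) ^ 2 := by nlinarith
  have := div_lt_div_of_pos_left h1 (show 0 < 2 * (2 * x' - (p + q)) by linarith)
    (show 2 * (2 * x' - (p + q)) < 2 * (2 * x - (p + q)) by linarith)
  linarith

theorem geodesicReflection_neg (p q x : ℝ) :
    geodesicReflection (-q) (-p) (-x) = -geodesicReflection p q x := by
  rw [geodesicReflection, geodesicReflection, ← div_neg]
  congr 1 <;> ring

theorem geodesicReflection_lt_of_lt_of_le {p q x x' : ℝ} (hqp : q < p) (h' : x' < x) (h : x ≤ q) :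
    geodesicReflection p q x < geodesicReflection p q x' := by
  have := geodesicReflection_lt_of_le_of_lt (p := -q) (q := -p) (neg_lt_neg hqp)
    (neg_le_neg h) (neg_lt_neg h')
  rw [geodesicReflection_neg, geodesicReflection_neg] at this
  exact neg_lt_neg_iff.1 this

theorem lt_geodesicReflection {p q x : ℝ} (hqp : q < p) (h : p ≤ x) :
    (p + q) / 2 < geodesicReflection p q x := by
  rw [geodesicReflection_eq_add_div (by linarith)]
  have h1 : 0 < (p - q) ^ 2 := by nlinarith
  have := div_pos h1 (show 0 < 2 * (2 * x - (p + q)) by linarith)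
  linarith

theorem geodesicReflection_lt {p q x : ℝ} (hqp : q < p) (h : x ≤ q) :
    geodesicReflection p q x < (p + q) / 2 := by
  have := lt_geodesicReflection (p := -q) (q := -p) (neg_lt_neg hqp) (neg_le_neg h)
  rw [geodesicReflection_neg] at this
  linarith

theorem geodesicReflection_left {p q : ℝ} (hqp : q < p) : geodesicReflection p q p = p := by
  rw [geodesicReflection_eq_add_div (by linarith), show 2 * p - (p + q) = p - q by ring]
  have : p - q ≠ 0 := by linarith
  field_simp
  ring

theorem geodesicReflection_right {p q : ℝ} (hqp : q < p) : geodesicReflection p q q = q := by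
  have := geodesicReflection_left (neg_lt_neg hqp)
  rw [geodesicReflection_neg] at this
  exact neg_inj.1 this

theorem geodesicReflection_mem {p q x : ℝ} (hqp : q < p) (h : x ≤ q ∨ p ≤ x) :
    geodesicReflection p q x ∈ Set.Icc q p := by
  rcases h with h | h
  · refine ⟨?_, by linarith [geodesicReflection_lt hqp h]⟩
    rcases h.eq_or_lt with rfl | h
    · rw [geodesicReflection_right hqp]
    · have := geodesicReflection_lt_of_lt_of_le hqp h le_rfl
      rw [geodesicReflection_right hqp] at this
      exact this.le
  · refine ⟨by linarith [lt_geodesicReflection hqp h], ?_⟩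
    rcases h.eq_or_lt with rfl | h
    · rw [geodesicReflection_left hqp]
    · have := geodesicReflection_lt_of_le_of_lt hqp le_rfl h
      rw [geodesicReflection_left hqp] at this
      exact this.le

/-- The vertices are listed along the principal sector, from its end `α`. -/
def IsOrdered (P : Fin 5 → ℝ) : Prop :=
  StrictAnti P ∧ ∀ i, P i ∈ Set.Icc (-sectorEnd) sectorEnd

theorem outside_side {P : Fin 5 → ℝ} (hP : StrictAnti P) {n : ℕ} (hn : n ≤ 3) (i : Fin 5) :
    P (Fin.ofNat 5 n + 1) < P (Fin.ofNat 5 n) ∧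
      (P i ≤ P (Fin.ofNat 5 n + 1) ∨ P (Fin.ofNat 5 n) ≤ P i) := by
  rw [hP.lt_iff_gt, hP.le_iff_ge, hP.le_iff_ge]
  interval_cases n <;> revert i <;> decide

theorem IsOrdered.nextPentagon {P : Fin 5 → ℝ} (hP : IsOrdered P) {n : ℕ} (hn : n ≤ 3) :
    IsOrdered (nextPentagon P n) := by
  constructor
  · rw [Fin.strictAnti_iff_succ_lt]
    intro i
    have hlt := (outside_side hP.1 hn 0).1
    unfold DoublePentagon.nextPentagon
    interval_cases n <;> fin_cases i <;>
    first
    | exact geodesicReflection_lt_of_le_of_lt hlt (hP.1.antitone (by decide)) (hP.1 (by decide))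
    | exact geodesicReflection_lt_of_lt_of_le hlt (hP.1 (by decide)) (hP.1.antitone (by decide))
    -- The index `n - i` wraps around from vertex 0 to vertex 4; these lie on different sides of the
    -- reflecting geodesic, and their images on different sides of the midpoint.
    | exact (geodesicReflection_lt hlt (hP.1.antitone (by decide))).trans
        (lt_geodesicReflection hlt (hP.1.antitone (by decide)))
  · intro i
    obtain ⟨h1, h2⟩ := outside_side hP.1 hn (Fin.ofNat 5 n - i)
    exact Set.Icc_subset_Icc (hP.2 _).1 (hP.2 _).2 (geodesicReflection_mem h1 h2)

/-! ### Equivariance of the tree of pentagons -/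

/-- Harmonic conjugates are defined by an equation that is invariant under projective maps. -/
theorem geodesicReflection_eq_iff {p q x r : ℝ} (hx : 2 * x - (p + q) ≠ 0) :
    geodesicReflection p q x = r ↔ (p - x) * (q - r) + (p - r) * (q - x) = 0 := by
  rw [geodesicReflection, div_eq_iff hx]
  constructor <;> intro h <;> linear_combination -h

/-- As linear forms in `x` and `y`, the rays `j - 1` and `j` have determinant `-1`. The difference
formula of a fractional linear map follows; its negative constant means that order is reversed. -/
theorem sectorMap_sub {j : ℕ} (h1 : 1 ≤ j) (h4 : j ≤ 4) :
    ∃ W : ℝ → ℝ, (∀ t ∈ Set.Icc (-sectorEnd) sectorEnd, 0 < W t) ∧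
      ∀ s ∈ Set.Icc (-sectorEnd) sectorEnd, ∀ t ∈ Set.Icc (-sectorEnd) sectorEnd,
        sectorMap j s - sectorMap j t = -4 * sectorEnd ^ 2 * (s - t) / (W s * W t) := by
  have hα := sectorEnd_pos
  have hsq := Real.goldenRatio_sq
  have hpos : ∀ t ∈ Set.Icc (-sectorEnd) sectorEnd,
      0 < sectorRay (sectorEnd - t) (sectorEnd + t) (j - 1) +
      sectorRay (sectorEnd - t) (sectorEnd + t) j := fun t ht =>
    sectorRay_add_pos (by linarith [ht.2]) (by linarith [ht.1]) (by linarith) h1 h4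
  refine ⟨_, hpos, fun s hs t ht => ?_⟩
  have hs := hpos s hs
  have ht := hpos t ht
  rw [sectorMap, sectorMap, div_sub_div _ _ hs.ne' ht.ne']
  congr 1
  generalize sectorEnd = a at *
  interval_cases j <;> simp only [Nat.reduceSub, sectorRay] <;> grind

theorem sectorMap_lt {j : ℕ} (h1 : 1 ≤ j) (h4 : j ≤ 4) {s t : ℝ}
    (hs : s ∈ Set.Icc (-sectorEnd) sectorEnd) (ht : t ∈ Set.Icc (-sectorEnd) sectorEnd)
    (hst : s < t) : sectorMap j t < sectorMap j s := by
  obtain ⟨W, hW, h⟩ := sectorMap_sub h1 h4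
  have h2 := h t ht s hs
  have h3 : -4 * sectorEnd ^ 2 * (t - s) / (W t * W s) < 0 := by
    refine div_neg_of_neg_of_pos ?_ (mul_pos (hW t ht) (hW s hs))
    have := sectorEnd_pos
    nlinarith [mul_pos (mul_pos this this) (sub_pos.2 hst)]
  linarith

theorem sectorMap_le {j : ℕ} (h1 : 1 ≤ j) (h4 : j ≤ 4) {s t : ℝ}
    (hs : s ∈ Set.Icc (-sectorEnd) sectorEnd) (ht : t ∈ Set.Icc (-sectorEnd) sectorEnd)
    (hst : s ≤ t) : sectorMap j t ≤ sectorMap j s := by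
  rcases hst.eq_or_lt with rfl | h
  · exact le_rfl
  · exact (sectorMap_lt h1 h4 hs ht h).le

/-- The reflected point is the harmonic conjugate of `x`, and in the harmonic relation the factors
of the difference formula cancel. The ends are exchanged because order is reversed. -/
theorem sectorMap_geodesicReflection {j : ℕ} (h1 : 1 ≤ j) (h4 : j ≤ 4) {p q x : ℝ}
    (hp : p ∈ Set.Icc (-sectorEnd) sectorEnd) (hq : q ∈ Set.Icc (-sectorEnd) sectorEnd)
    (hx : x ∈ Set.Icc (-sectorEnd) sectorEnd) (hqp : q < p) (h : x ≤ q ∨ p ≤ x) :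
    geodesicReflection (sectorMap j q) (sectorMap j p) (sectorMap j x) =
      sectorMap j (geodesicReflection p q x) := by
  have hr : geodesicReflection p q x ∈ Set.Icc (-sectorEnd) sectorEnd :=
    Set.Icc_subset_Icc hq.1 hp.2 (geodesicReflection_mem hqp h)
  have hlt := sectorMap_lt h1 h4 hq hp hqp
  have hne : 2 * sectorMap j x - (sectorMap j q + sectorMap j p) ≠ 0 := by
    rcases h with h | h
    · have := sectorMap_le h1 h4 hx hq h
      linarith
    · have := sectorMap_le h1 h4 hp hx h
      linarith
  have hne' : 2 * x - (p + q) ≠ 0 := by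
    rcases h with h | h <;> linarith
  have hharm := (geodesicReflection_eq_iff hne').1 rfl
  rw [geodesicReflection_eq_iff hne]
  generalize geodesicReflection p q x = r at *
  obtain ⟨W, hW, hM⟩ := sectorMap_sub h1 h4
  rw [hM q hq x hx, hM p hp r hr, hM q hq r hr, hM p hp x hx]
  have := (hW p hp).ne'
  have := (hW q hq).ne'
  have := (hW r hr).ne'
  have := (hW x hx).ne'
  field_simp
  linear_combination 16 * sectorEnd ^ 4 * hharm

/-- Reversing the order of the vertices sends vertex `i` to `4 - i`, so the side from `n` to `n + 1`
becomes the side number `3 - n`. -/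
theorem nextPentagon_sectorMap {j : ℕ} (h1 : 1 ≤ j) (h4 : j ≤ 4) {P P' : Fin 5 → ℝ}
    (hP : IsOrdered P) (hP' : ∀ i, P' i = sectorMap j (P (4 - i))) {n : ℕ} (hn : n ≤ 3)
    (i : Fin 5) : nextPentagon P' (3 - n) i = sectorMap j (nextPentagon P n (4 - i)) := by
  have e : 4 - Fin.ofNat 5 (3 - n) = Fin.ofNat 5 n + 1 ∧
      4 - (Fin.ofNat 5 (3 - n) + 1) = Fin.ofNat 5 n ∧
      4 - (Fin.ofNat 5 (3 - n) - i) = Fin.ofNat 5 n - (4 - i) := by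
    clear hP hP'
    interval_cases n <;> revert i <;> decide
  obtain ⟨hlt, hout⟩ := outside_side hP.1 hn (Fin.ofNat 5 n - (4 - i))
  rw [nextPentagon, nextPentagon, ← sectorMap_geodesicReflection h1 h4 (hP.2 _) (hP.2 _) (hP.2 _)
    hlt hout, hP', hP', hP']
  rw [e.1, e.2.1, e.2.2]

theorem foldl_nextPentagon_sectorMap {j : ℕ} (h1 : 1 ≤ j) (h4 : j ≤ 4) (l : List ℕ)
    (hl : ∀ m ∈ l, m ≤ 3) {P P' : Fin 5 → ℝ} (hP : IsOrdered P)
    (hP' : ∀ i, P' i = sectorMap j (P (4 - i))) (i : Fin 5) :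
    (l.map (fun m => 3 - m)).foldl nextPentagon P' i =
      sectorMap j (l.foldl nextPentagon P (4 - i)) := by
  induction l generalizing P P' with
  | nil => exact hP' i
  | cons n l ih =>
    have hn := hl n List.mem_cons_self
    exact ih (fun m hm => hl m (List.mem_cons_of_mem _ hm)) (hP.nextPentagon hn)
      (nextPentagon_sectorMap h1 h4 hP hP' hn)

theorem firstPentagon_eq : firstPentagon =
    ![1 - φ / 2, (5 * φ - 8) / 2, 0, (8 - 5 * φ) / 2, φ / 2 - 1] := by
  have hsq := Real.goldenRatio_sq
  have h0 := Real.goldenRatio_ne_zero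
  have e1 : geodesicReflection (1 - φ / 2) (φ / 2 - 1) (φ / 2) = (5 * φ - 8) / 2 := by
    rw [geodesicReflection, div_eq_iff (by intro h; apply h0; linarith)]
    grind
  have e2 : geodesicReflection (1 - φ / 2) (φ / 2 - 1) (-(φ / 2)) = (8 - 5 * φ) / 2 := by
    rw [geodesicReflection, div_eq_iff (by intro h; apply h0; linarith)]
    grind
  rw [firstPentagon, e1, e2]

theorem isOrdered_firstPentagon : IsOrdered firstPentagon := by
  have hφ := goldenRatio_gt
  have hφ' : φ < 1625 / 1000 := by
    have := Real.goldenRatio_sq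
    nlinarith
  have hanti : StrictAnti firstPentagon := by
    rw [firstPentagon_eq, Fin.strictAnti_iff_succ_lt]
    intro i
    fin_cases i <;> simp <;> linarith
  refine ⟨hanti, fun i => ?_⟩
  have e0 : firstPentagon 0 = sectorEnd := rfl
  have e4 : firstPentagon 4 = -sectorEnd := by
    rw [sectorEnd, neg_sub]; rfl
  rw [← e4, ← e0]
  exact ⟨hanti.antitone (Fin.le_last i), hanti.antitone (Fin.zero_le i)⟩

/-- At the end of the sector `x = 0`, and the rays become multiples of `y` by 1, `φ`, `φ`, 1 and 0.
-/
theorem sectorMap_sectorEnd {j : ℕ} (h1 : 1 ≤ j) (h4 : j ≤ 4) :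
    sectorMap j sectorEnd = alpha [] j := by
  have hsq := Real.goldenRatio_sq
  have hα := sectorEnd_pos
  have h := sectorRay_add_pos (x := sectorEnd - sectorEnd) (y := sectorEnd + sectorEnd)
    (by linarith) (by linarith) (by linarith) h1 h4
  rw [sectorMap, div_eq_iff h.ne']
  clear h hα
  unfold alpha pentagon
  rw [List.foldl_nil, firstPentagon_eq, sectorEnd]
  interval_cases j <;> simp only [sectorRay, Nat.reduceSub] <;> generalize φ = f at * <;>
  simp [Fin.ofNat] <;> grind

/-- The rotation moves the first pentagon across another side of the pentagon of generation 0, and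
the reflection in the principal side then puts it next to the first pentagon, across its side `j -
1`. It starts the induction over the tree. -/
theorem nextPentagon_firstPentagon {j : ℕ} (h1 : 1 ≤ j) (h4 : j ≤ 4) (i : Fin 5) :
    nextPentagon firstPentagon (j - 1) i = sectorMap j (firstPentagon (4 - i)) := by
  have hsq := Real.goldenRatio_sq
  have hα := sectorEnd_pos
  have hmem := isOrdered_firstPentagon.2 (4 - i)
  have h := sectorRay_add_pos (x := sectorEnd - firstPentagon (4 - i))
    (y := sectorEnd + firstPentagon (4 - i))
    (by linarith [hmem.2]) (by linarith [hmem.1]) (by linarith) h1 h4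
  obtain ⟨hlt, hout⟩ := outside_side isOrdered_firstPentagon.1 (n := j - 1) (by omega)
    (Fin.ofNat 5 (j - 1) - i)
  have hne : 2 * firstPentagon (Fin.ofNat 5 (j - 1) - i) -
      (firstPentagon (Fin.ofNat 5 (j - 1)) + firstPentagon (Fin.ofNat 5 (j - 1) + 1)) ≠ 0 := by
    rcases hout with h | h <;> linarith
  rw [sectorMap, nextPentagon, geodesicReflection, div_eq_div_iff hne h.ne']
  clear h hα hmem hlt hout hne
  rw [firstPentagon_eq, sectorEnd]
  interval_cases j <;> fin_cases i <;> simp [sectorRay, Fin.ofNat] <;> grind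

theorem alpha_cons {j : ℕ} (h1 : 1 ≤ j) (h4 : j ≤ 4) (l : List ℕ) (hl : ∀ m ∈ l, m ≤ 3) {n : ℕ}
    (hn : n ≤ 4) :
    alpha ((j - 1) :: l.map (fun m => 3 - m)) (4 - n) = sectorMap j (alpha l n) := by
  have h := foldl_nextPentagon_sectorMap h1 h4 l hl isOrdered_firstPentagon
    (nextPentagon_firstPentagon h1 h4) (Fin.ofNat 5 (4 - n))
  have e : 4 - Fin.ofNat 5 (4 - n) = Fin.ofNat 5 n := by
    interval_cases n <;> decide
  rw [e] at h
  exact h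

theorem map_three_sub_map_three_sub {l : List ℕ} (hl : ∀ m ∈ l, m ≤ 3) :
    (l.map (fun m => 3 - m)).map (fun m => 3 - m) = l := by
  rw [List.map_map]
  conv_rhs => rw [← List.map_id l]
  refine List.map_congr_left fun m hm => ?_
  have := hl m hm
  simp only [Function.comp_apply, id]
  omega

/-- Every direction with a last index from 1 to 3 is the image under some `sectorMap` of a direction
one generation lower, and finally of `sectorEnd`, where the weights are known. -/
theorem alpha_mem_and_hasGoldenWeights (l : List ℕ) (hl : ∀ m ∈ l, m ≤ 3) {n : ℕ} (h1 : 1 ≤ n)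
    (h3 : n ≤ 3) : alpha l n ∈ Set.Icc (-sectorEnd) sectorEnd ∧
      (principalFlow (alpha l n)).HasGoldenWeights := by
  have hα := sectorEnd_pos
  induction hN : l.length generalizing l n with
  | zero =>
    have hmem : sectorEnd ∈ Set.Icc (-sectorEnd) sectorEnd := ⟨by linarith, le_rfl⟩
    rw [List.length_eq_zero_iff.1 hN, ← sectorMap_sectorEnd h1 (by omega)]
    exact ⟨sectorMap_mem h1 (by omega) hmem,
      (renormalizes_sectorMap h1 (by omega) hmem).hasGoldenWeights hasGoldenWeights_sectorEnd⟩
  | succ N ih =>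
    obtain ⟨m, l, rfl⟩ := List.exists_cons_of_length_eq_add_one hN
    have hm := hl m List.mem_cons_self
    have hl' : ∀ k ∈ l, k ≤ 3 := fun k hk => hl k (List.mem_cons_of_mem _ hk)
    have hl'' : ∀ k ∈ l.map (fun k => 3 - k), k ≤ 3 := by
      intro k hk
      obtain ⟨a, -, rfl⟩ := List.mem_map.1 hk
      exact Nat.sub_le _ _
    -- The complemented indices `3 - k` and `4 - n` are used, so that complementing once more gives
    -- back `l` and `n`; `4 - n` stays between 1 and 3.
    have h := alpha_cons (j := m + 1) (by omega) (by omega) _ hl'' (n := 4 - n) (by omega)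
    rw [map_three_sub_map_three_sub hl', Nat.add_sub_cancel,
      show 4 - (4 - n) = n by omega] at h
    obtain ⟨hmem, hD⟩ := ih _ hl'' (n := 4 - n) (by omega) (by omega) (by simpa using hN)
    rw [h]
    exact ⟨sectorMap_mem (by omega) (by omega) hmem,
      (renormalizes_sectorMap (by omega) (by omega) hmem).hasGoldenWeights hD⟩

theorem orbits_sectorMap {j : ℕ} (h1 : 1 ≤ j) (h4 : j ≤ 4) {t : ℝ}
    (ht : t ∈ Set.Icc (-sectorEnd) sectorEnd) (hD : (principalFlow t).HasGoldenWeights)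
    (w : List (ZMod 5)) :
    (IsShortOrbit t w → IsShortOrbit (sectorMap j t) (enhance (shiftWord j w))) ∧
      (IsLongOrbit t w → IsLongOrbit (sectorMap j t) (enhance (shiftWord j w))) := by
  have r := renormalizes_sectorMap h1 h4 ht
  have hD' := r.hasGoldenWeights hD
  have ht' := sectorMap_mem h1 h4 ht
  rw [isShortOrbit_iff ht hD, isShortOrbit_iff ht' hD', isLongOrbit_iff ht hD,
    isLongOrbit_iff ht' hD']
  exact ⟨r.isLeastWord, r.isGreatestWord⟩

end DoublePentagon

end

open DoublePentagon
theorem theorem5 :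
    -- from generation `k ≥ 1`, with `l = [n₁, …, n_{k-1}]` and `n = n_k`
    (∀ (l : List ℕ) (n : ℕ), (∀ m ∈ l, m ≤ 3) → 1 ≤ n → n ≤ 3 →
      ∀ (j : ℕ), 1 ≤ j → j ≤ 4 → ∀ (w : List (ZMod 5)),
        (IsShortOrbit (alpha l n) w →
          IsShortOrbit (alpha ((j - 1) :: l.map (fun m => 3 - m)) (4 - n))
            (enhance (shiftWord j w))) ∧
        (IsLongOrbit (alpha l n) w →
          IsLongOrbit (alpha ((j - 1) :: l.map (fun m => 3 - m)) (4 - n))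
            (enhance (shiftWord j w)))) ∧
    -- from generation `0`
    (∀ (j : ℕ), 1 ≤ j → j ≤ 4 → ∀ (w : List (ZMod 5)),
        (IsShortOrbit (alpha [] 0) w →
          IsShortOrbit (alpha [] j) (enhance (shiftWord j w))) ∧
        (IsLongOrbit (alpha [] 0) w →
          IsLongOrbit (alpha [] j) (enhance (shiftWord j w)))) := by

  constructor
  · intro l n hl h1 h3 j hj1 hj4 w
    obtain ⟨hmem, hD⟩ := alpha_mem_and_hasGoldenWeights l hl h1 h3
    rw [alpha_cons hj1 hj4 l hl (by omega)]
    exact orbits_sectorMap hj1 hj4 hmem hD w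
  · intro j hj1 hj4 w
    rw [← sectorMap_sectorEnd hj1 hj4]
    -- `alpha [] 0` unfolds to `sectorEnd`.
    exact orbits_sectorMap hj1 hj4 ⟨by linarith [sectorEnd_pos], le_rfl⟩
      hasGoldenWeights_sectorEnd w
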